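/- Let \(p>2\) be a prime, \(k\) an algebraically closed field of characteristic \(p\), and \(G=\mathrm{SL}_2(\mathbb{F}_p)\). All \(kG\)-modules are finite-dimensional over \(k\), and tensor products are over \(k\) with the diagonal action. For \(n\ge 1\) let \(V_n\) be the \(n\)-dimensional \(kG\)-module of homogeneous polynomials of degree \(n-1\) in \(X,Y\) over \(k\), where \(\begin{pmatrix}a&b\\c&d\end{pmatrix}f(X,Y)=f(aX+cY,\,bX+dY)\). For \(1\le n\le p-1\) let \(A^{(n)}\) be the \((p-1)\times(p-1)\) matrix whose entry \(A^{(n)}_{i,j}\) is the multiplicity of \(V_j\) as an indecomposable direct summand of \(V_i\otimes V_n\); let \(\mathcal{G}^{(n)}\) be the graph (with loops) on \(\{1,\dots,p-1\}\) with adjacency matrix \(A^{(n)}\); and let \(T\) be the \((p-1)\times(p-1)\) matrix with \(T_{i,j}=1\) if \(i+j=p\) and \(T_{i,j}=0\) otherwise. The projective-free part \(\Omega^0(M)\) of a module \(M\) is the module without nonzero projective direct summands, unique up to isomorphism, such that \(M\cong\Omega^0(M)\oplus Q\) with \(Q\) projective. Let \(G_0(kG)\) be the Grothendieck group of \(kG\)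 (one generator \([V]\) for each module, one relation \([W]=[U]+[V]\) for each short exact sequence \(0\to U\to W\to V\to 0\)), a commutative ring with \([V][W]=[V\otimes W]\), and let \(\mathfrak{p}\) be the subgroup generated by the classes of projective modules, which is an ideal. Then: (a) for all \(1\le i,j,l\le p-1\), \(V_l\) is isomorphic to a direct summand of \(V_i\otimes V_j\) if and only if it is isomorphic to a direct summand of \(V_{p-i}\otimes V_{p-j}\); (b) \(A^{(n)}=TA^{(p-n)}=A^{(p-n)}T\) for all \(1\le n\le p-1\); (c) \(TA^{(n)}T=A^{(n)}\) for all \(1\le n\le p-1\); (d) for all \(1\le n\le p-1\), the map \(i\mapsto p-i\) is a graph automorphism of \(\mathcal{G}^{(n)}\), and the subgraph of \(\mathcal{G}^{(n)}\) induced on the even vertices is isomorphic to the one induced on the odd vertices; (e) \(\Omega^0(V_i\otimes V_j)\cong\Omega^0(V_{p-i}\otimes V_{p-j})\) for all \(1\le i,j\le p-1\); (f) \([V_i\otimes V_j]+\mathfrak{p}=[V_{p-i}\otimes V_{p-j}]+\mathfrak{p}\) for all \(1\le i,j\le p-1\); (g) there is exactly one automorphism \(\rho\) of the abelian group \(G_0(kG)/\mathfrak{p}\)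 with \(\rho([V_i]+\mathfrak{p})=[V_{p-i}]+\mathfrak{p}\) for all \(1\le i\le p-1\), and \(\rho\) is \(G_0(kG)\)-equivariant, that is, \(\rho(ax)=a\rho(x)\) for all \(a\in G_0(kG)\) and \(x\in G_0(kG)/\mathfrak{p}\). -/

import Mathlib

noncomputable section

namespace SL2Rep

open scoped TensorProduct MonoidAlgebra

universe u v

/-! ### Summands, multiplicities and projective-free parts of representations -/

section Summands

/- The group enters the definitions of this section only as a monoid, and the spaces only as
additive monoids; this is for the sake of unification. -/
variable {k : Type*} [Field k] {G : Type*} [Monoid G]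
variable {V : Type*} [AddCommMonoid V] [Module k V]
variable {W : Type*} [AddCommMonoid W] [Module k W]

/-- `σ` is isomorphic to a direct summand of `τ`. -/
def IsSummand (σ : Representation k G V) (τ : Representation k G W) : Prop :=
  ∃ S S' : Subrepresentation τ, IsCompl S S' ∧ Nonempty (σ.Equiv S.toRepresentation)

/-- The multiplicity of `σ` as a direct summand of `τ`: the largest `m` such that the direct sum
of `m` copies of `σ` is isomorphic to a direct summand of `τ`. -/
def summandMultiplicity (σ : Representation k G V) (τ : Representation k G W) : ℕ :=
  sSup {m : ℕ | IsSummand (Representation.directSum fun _ : Fin m => σ) τ}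

/-- `τ` is projective as a module over the group algebra. -/
def IsProjective (τ : Representation k G W) : Prop :=
  Module.Projective k[G] τ.asModule

/-- `τ` has no nonzero projective direct summand. -/
def IsProjectiveFree (τ : Representation k G W) : Prop :=
  ∀ S S' : Subrepresentation τ, IsCompl S S' → IsProjective S.toRepresentation → S = ⊥

/-- `S` is a projective-free part of `τ`: it has no nonzero projective direct summand, and it has
a projective complement in `τ`. -/
def IsProjectiveFreePart (τ : Representation k G W) (S : Subrepresentation τ) : Prop :=
  IsProjectiveFree S.toRepresentation ∧
    ∃ Q : Subrepresentation τ, IsCompl S Q ∧ IsProjective Q.toRepresentation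

/-- The projective-free parts of `σ` and `τ` are isomorphic: both exist, and every choice of the
one is isomorphic to every choice of the other. -/
def ProjectiveFreePartsIso (σ : Representation k G V) (τ : Representation k G W) : Prop :=
  (∃ S, IsProjectiveFreePart σ S) ∧ (∃ S, IsProjectiveFreePart τ S) ∧
    ∀ S S', IsProjectiveFreePart σ S → IsProjectiveFreePart τ S' →
      Nonempty (S.toRepresentation.Equiv S'.toRepresentation)

end Summands

/-! ### The tensor product with a projective module is projective -/

section Projective

variable {k : Type*} [Field k] {G : Type*} [Group G]
variable {V : Type*} [AddCommGroup V] [Module k V]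
variable {W : Type*} [AddCommGroup W] [Module k W]

theorem IsProjective.tprod {ρ : Representation k G W} (hρ : IsProjective ρ)
    (σ : Representation k G V) : IsProjective (σ.tprod ρ) := by
  unfold IsProjective at *
  refine Module.Projective.of_lifting_property'' fun f hf => ?_
  let τ : Representation k G ((σ.tprod ρ).asModule →₀ k[G]) := Representation.ofModule' _
  have hτ : ∀ (g : G) (x : (σ.tprod ρ).asModule →₀ k[G]),
      τ g x = MonoidAlgebra.single g (1 : k) • x := fun g x => by
    simp [τ, Representation.ofModule']
  have hfτ : ∀ (g : G) (x : (σ.tprod ρ).asModule →₀ k[G]),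
      (f (τ g x) : V ⊗[k] W) = σ.tprod ρ g (f x) := fun g x => by
    rw [hτ, map_smul, Representation.single_smul, one_smul]
    rfl
  let fk : ((σ.tprod ρ).asModule →₀ k[G]) →ₗ[k] (V ⊗[k] W) :=
    { toFun := fun x => f x
      map_add' := fun x y => map_add f x y
      map_smul' := fun c x => by
        rw [RingHom.id_apply, ← algebraMap_smul k[G] c x, map_smul]
        change (algebraMap k k[G] c) • f x = _
        rw [MonoidAlgebra.coe_algebraMap, Function.comp_apply, Algebra.algebraMap_self_apply,
          Representation.single_smul, map_one]
        rfl }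
  -- a `k`-linear section of `f`
  obtain ⟨s, hs⟩ := fk.exists_rightInverse_of_surjective (LinearMap.range_eq_top.2 hf)
  have hs' : ∀ x, fk (s x) = x := fun x => LinearMap.congr_fun hs x
  let F : (σ.linHom τ).IntertwiningMap (σ.linHom (σ.tprod ρ)) :=
    { toLinearMap := LinearMap.compRight k fk
      isIntertwining' := fun g => by
        ext h v
        simp only [LinearMap.comp_apply, LinearMap.compRight_apply, Representation.linHom_apply]
        exact hfτ _ _ }
  let E : ρ.IntertwiningMap (σ.linHom (σ.tprod ρ)) :=
    { toLinearMap := (TensorProduct.mk k V W).flip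
      isIntertwining' := fun g => by
        ext w v
        simp [Representation.linHom_apply] }
  obtain ⟨h, hh⟩ := Module.projective_lifting_property
    (Representation.IntertwiningMap.equivLinearMapAsModule _ _ F)
    (Representation.IntertwiningMap.equivLinearMapAsModule _ _ E) (fun b => ⟨s ∘ₗ b, by
      refine LinearMap.ext fun v => ?_
      exact hs' _⟩)
  let H := (Representation.IntertwiningMap.equivLinearMapAsModule _ _).symm h
  have hH : ∀ w v, fk (H w v) = v ⊗ₜ w := fun w v =>
    LinearMap.congr_fun (LinearMap.congr_fun hh w) v
  have hHg : ∀ g w, H (ρ g w) = τ g ∘ₗ H w ∘ₗ σ g⁻¹ := fun g w => Representation.IntertwiningMap.isIntertwining _ _ H g w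
  let K : (σ.tprod ρ).IntertwiningMap τ :=
    { toLinearMap := TensorProduct.lift H.toLinearMap.flip
      isIntertwining' := fun g => by
        ext v w
        simp [Representation.IntertwiningMap.toLinearMap_apply, hHg] }
  let K' := Representation.IntertwiningMap.equivLinearMapAsModule _ _ K
  let I : τ.asModule →ₗ[k[G]] ((σ.tprod ρ).asModule →₀ k[G]) :=
    { toFun := fun x => x
      map_add' := fun _ _ => rfl
      map_smul' := fun m x => by
        rw [RingHom.id_apply]
        change τ.asAlgebraHom m x = _
        have : τ.asAlgebraHom = Algebra.lsmul k k _ :=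
          (MonoidAlgebra.lift k (Module.End k _) G).apply_symm_apply _
        rw [this]
        rfl }
  refine ⟨I.comp K', LinearMap.ext fun x => ?_⟩
  have key : fk ∘ₗ K.toLinearMap = LinearMap.id := by
    ext v w
    simpa [K] using hH w v
  exact LinearMap.congr_fun key x

end Projective

/-! ### The Grothendieck ring of finite-dimensional modules -/

section Grothendieck

variable (k : Type u) [Field k] (G : Type v) [Group G]

variable {k G} in
/-- The representation on the underlying space of a finite-dimensional `kG`-module. -/
abbrev _root_.FDRep.rep (V : FDRep k G) : Representation k G V := V.ρ

/-- The relators `[W] - ([U] + [V])`, one for each short exact sequence `0 → U → W → V → 0` of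
finite-dimensional `kG`-modules. -/
def relators : Set (FreeAbelianGroup (FDRep k G)) :=
  {x | ∃ (U W V : FDRep k G) (f : U.rep.IntertwiningMap W.rep) (g : W.rep.IntertwiningMap V.rep),
    Function.Injective f ∧ Function.Exact f g ∧ Function.Surjective g ∧
    x = FreeAbelianGroup.of W - (FreeAbelianGroup.of U + FreeAbelianGroup.of V)}

/-- The Grothendieck group `G₀(kG)`. -/
def G0 : Type (max v (u + 1)) :=
  FreeAbelianGroup (FDRep k G) ⧸ AddSubgroup.closure (relators k G)

instance : AddCommGroup (G0 k G) :=
  inferInstanceAs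
    (AddCommGroup (FreeAbelianGroup (FDRep k G) ⧸ AddSubgroup.closure (relators k G)))

variable {k G}

/-- The class of a finite-dimensional `kG`-module in `G₀(kG)`. -/
def cls (V : FDRep k G) : G0 k G :=
  QuotientAddGroup.mk (FreeAbelianGroup.of V)

/-- The tensor product over `k` of two modules, with the diagonal action. -/
abbrev tens (V W : FDRep k G) : FDRep k G := FDRep.of (V.rep.tprod W.rep)

theorem cls_exact {U W V : FDRep k G} (f : U.rep.IntertwiningMap W.rep) (g : W.rep.IntertwiningMap V.rep)
    (hf : Function.Injective f) (hfg : Function.Exact f g) (hg : Function.Surjective g) :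
    cls W = cls U + cls V := by
  refine sub_eq_zero.1 ((QuotientAddGroup.eq_zero_iff
    (FreeAbelianGroup.of W - (FreeAbelianGroup.of U + FreeAbelianGroup.of V))).2 ?_)
  exact AddSubgroup.subset_closure ⟨U, W, V, f, g, hf, hfg, hg, rfl⟩

theorem cls_equiv {V W : FDRep k G} (e : V.rep.Equiv W.rep) : cls V = cls W := by
  let Z : FDRep k G := FDRep.of (Representation.trivial k G PUnit.{u + 1})
  have h0 : cls Z = 0 := by
    have := cls_exact (U := Z) (W := Z) (V := Z) (Representation.IntertwiningMap.id _)
      (Representation.IntertwiningMap.id _) (fun _ _ h => h)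
      (fun x => ⟨fun _ => ⟨x, rfl⟩, fun _ => rfl⟩) (fun x => ⟨x, rfl⟩)
    simpa using this
  have := cls_exact (U := Z) (W := V) (V := W) 0 e.toIntertwiningMap
    (fun _ _ _ => rfl)
    (fun x => ⟨fun h => ⟨0, by
      have : e x = e 0 := by rw [map_zero]; exact h
      exact (e.injective this).symm⟩, by
      rintro ⟨y, rfl⟩
      exact map_zero e⟩) e.surjective
  rw [this, h0, zero_add]

theorem cls_tens_exact_left (M : FDRep k G) {U W V : FDRep k G} (f : U.rep.IntertwiningMap W.rep)
    (g : W.rep.IntertwiningMap V.rep) (hf : Function.Injective f) (hfg : Function.Exact f g)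
    (hg : Function.Surjective g) : cls (tens M W) = cls (tens M U) + cls (tens M V) :=
  cls_exact (U := tens M U) (W := tens M W) (V := tens M V)
    ⟨f.toLinearMap.lTensor M, fun a => by
      ext m u; simp [f.isIntertwining]⟩
    ⟨g.toLinearMap.lTensor M, fun a => by
      ext m u; simp [g.isIntertwining]⟩
    (Module.Flat.lTensor_preserves_injective_linearMap f.toLinearMap hf)
    (lTensor_exact M hfg hg) (LinearMap.lTensor_surjective M hg)

theorem cls_tens_comm (V W : FDRep k G) : cls (tens V W) = cls (tens W V) :=
  cls_equiv (V := tens V W) (W := tens W V)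
    (Representation.Equiv.mk (TensorProduct.comm k V W) fun g => by ext; simp)

theorem cls_tens_assoc (U V W : FDRep k G) :
    cls (tens (tens U V) W) = cls (tens U (tens V W)) :=
  cls_equiv (V := tens (tens U V) W) (W := tens U (tens V W))
    (Representation.Equiv.mk (TensorProduct.assoc k U V W) fun g => by
      ext; simp)

/-- The trivial module. -/
abbrev triv : FDRep k G := FDRep.of (Representation.trivial k G k)

theorem cls_triv_tens (V : FDRep k G) : cls (tens triv V) = cls V :=
  cls_equiv (V := tens triv V) (W := V)
    (Representation.Equiv.mk (TensorProduct.lid k V) fun g => by ext; simp)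

theorem cls_tens_exact_right (M : FDRep k G) {U W V : FDRep k G} (f : U.rep.IntertwiningMap W.rep)
    (g : W.rep.IntertwiningMap V.rep) (hf : Function.Injective f) (hfg : Function.Exact f g)
    (hg : Function.Surjective g) : cls (tens W M) = cls (tens U M) + cls (tens V M) := by
  simpa only [cls_tens_comm _ M] using cls_tens_exact_left M f g hf hfg hg

/-- The additive map out of `G₀(kG)` induced by an additive function on modules. -/
def G0.lift {A : Type*} [AddCommGroup A] (φ : FDRep k G → A)
    (hφ : ∀ (U W V : FDRep k G) (f : U.rep.IntertwiningMap W.rep) (g : W.rep.IntertwiningMap V.rep),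
      Function.Injective f → Function.Exact f g → Function.Surjective g → φ W = φ U + φ V) :
    G0 k G →+ A :=
  QuotientAddGroup.lift _ (FreeAbelianGroup.lift φ) <| by
    rw [AddSubgroup.closure_le]
    rintro _ ⟨U, W, V, f, g, hf, hfg, hg, rfl⟩
    simp [hφ U W V f g hf hfg hg]

theorem G0.lift_cls {A : Type*} [AddCommGroup A] (φ : FDRep k G → A) (hφ) (V : FDRep k G) :
    G0.lift φ hφ (cls V) = φ V :=
  FreeAbelianGroup.lift_apply_of φ V

theorem G0.hom_ext {A : Type*} [AddCommGroup A] {φ ψ : G0 k G →+ A}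
    (h : ∀ V, φ (cls V) = ψ (cls V)) : φ = ψ :=
  QuotientAddGroup.addMonoidHom_ext _ (FreeAbelianGroup.lift_ext _ _ h)

variable (k G) in
/-- The product on `G₀(kG)`: the biadditive map with `[V] * [W] = [V ⊗ W]`. -/
def G0.mulHom : G0 k G →+ G0 k G →+ G0 k G :=
  G0.lift
    (fun V => G0.lift (fun W => cls (tens V W)) fun _ _ _ f g => cls_tens_exact_left V f g)
    fun U W V f g hf hfg hg => G0.hom_ext fun M => by
      rw [AddMonoidHom.add_apply, G0.lift_cls, G0.lift_cls, G0.lift_cls]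
      exact cls_tens_exact_right M f g hf hfg hg

instance : Mul (G0 k G) := ⟨fun x y => G0.mulHom k G x y⟩

instance : One (G0 k G) := ⟨cls triv⟩

theorem cls_mul_cls (V W : FDRep k G) : cls V * cls W = cls (tens V W) := by
  change G0.mulHom k G (cls V) (cls W) = _
  rw [G0.mulHom, G0.lift_cls, G0.lift_cls]

theorem G0.mul_add' (x y z : G0 k G) : x * (y + z) = x * y + x * z :=
  map_add (G0.mulHom k G x) y z

theorem G0.add_mul' (x y z : G0 k G) : (x + y) * z = x * z + y * z :=
  DFunLike.congr_fun (map_add (G0.mulHom k G) x y) z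

theorem G0.induction {P : G0 k G → Prop} (h0 : P 0) (hcls : ∀ V, P (cls V))
    (hneg : ∀ x, P x → P (-x)) (hadd : ∀ x y, P x → P y → P (x + y)) (x : G0 k G) : P x := by
  obtain ⟨x, rfl⟩ := QuotientAddGroup.mk_surjective x
  exact FreeAbelianGroup.induction_on x h0 hcls (fun V h => hneg _ h) (fun x y hx hy => hadd _ _ hx hy)

theorem G0.mul_comm' (x y : G0 k G) : x * y = y * x := by
  have : G0.mulHom k G = (G0.mulHom k G).flip :=
    G0.hom_ext fun V => G0.hom_ext fun W => by
      rw [AddMonoidHom.flip_apply]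
      exact (cls_mul_cls V W).trans ((cls_tens_comm V W).trans (cls_mul_cls W V).symm)
  exact DFunLike.congr_fun (DFunLike.congr_fun this x) y

theorem G0.one_mul' (x : G0 k G) : 1 * x = x := by
  have : G0.mulHom k G (cls triv) = AddMonoidHom.id _ :=
    G0.hom_ext fun V => (cls_mul_cls triv V).trans (cls_triv_tens V)
  exact DFunLike.congr_fun this x

theorem G0.mul_assoc' (x y z : G0 k G) : x * y * z = x * (y * z) := by
  have h1 : ∀ (U V : FDRep k G) (z : G0 k G), cls U * cls V * z = cls U * (cls V * z) := by
    intro U V z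
    have : G0.mulHom k G (cls U * cls V) =
        (G0.mulHom k G (cls U)).comp (G0.mulHom k G (cls V)) := G0.hom_ext fun W => by
      change cls U * cls V * cls W = cls U * (cls V * cls W)
      simp only [cls_mul_cls]
      exact cls_tens_assoc U V W
    exact DFunLike.congr_fun this z
  have h2 : ∀ (U : FDRep k G) (y z : G0 k G), cls U * y * z = cls U * (y * z) := by
    intro U y z
    have : ((G0.mulHom k G).flip z).comp (G0.mulHom k G (cls U)) =
        (G0.mulHom k G (cls U)).comp ((G0.mulHom k G).flip z) := G0.hom_ext fun V => h1 U V z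
    exact DFunLike.congr_fun this y
  have : ((G0.mulHom k G).flip z).comp ((G0.mulHom k G).flip y) =
      (G0.mulHom k G).flip (y * z) := G0.hom_ext fun U => h2 U y z
  exact DFunLike.congr_fun this x

instance : CommRing (G0 k G) :=
  { (inferInstance : AddCommGroup (G0 k G)), (inferInstance : Mul (G0 k G)),
    (inferInstance : One (G0 k G)) with
    left_distrib := G0.mul_add'
    right_distrib := G0.add_mul'
    zero_mul := fun x => DFunLike.congr_fun (map_zero (G0.mulHom k G)) x
    mul_zero := fun x => map_zero (G0.mulHom k G x)
    mul_assoc := G0.mul_assoc'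
    one_mul := G0.one_mul'
    mul_one := fun x => (G0.mul_comm' x 1).trans (G0.one_mul' x)
    mul_comm := G0.mul_comm' }

variable (k G) in
/-- The subgroup of `G₀(kG)` generated by the classes of projective modules. -/
def projSubgroup : AddSubgroup (G0 k G) :=
  AddSubgroup.closure {x | ∃ P : FDRep k G, IsProjective P.rep ∧ x = cls P}

theorem mul_mem_projSubgroup (x : G0 k G) {y : G0 k G} (hy : y ∈ projSubgroup k G) :
    x * y ∈ projSubgroup k G := by
  suffices h : ∀ V : FDRep k G, projSubgroup k G ≤
      (projSubgroup k G).comap (G0.mulHom k G (cls V)) by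
    induction x using G0.induction with
    | h0 => rw [zero_mul]; exact zero_mem _
    | hcls V => exact h V hy
    | hneg x hx => rw [neg_mul]; exact neg_mem hx
    | hadd x y hx hy => rw [add_mul]; exact add_mem hx hy
  intro V
  refine (AddSubgroup.closure_le _).2 ?_
  rintro _ ⟨P, hP, rfl⟩
  refine AddSubgroup.subset_closure ⟨tens V P, hP.tprod V.rep, cls_mul_cls V P⟩

variable (k G) in
/-- The subgroup generated by the classes of projective modules, regarded as an ideal of the
ring `G₀(kG)`. -/
def projIdeal : Ideal (G0 k G) :=
  { (projSubgroup k G).toAddSubmonoid with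
    smul_mem' := fun x _ hy => mul_mem_projSubgroup x hy }

end Grothendieck

/-! ### The modules `V_n` of `SL₂(𝔽_p)`, the matrices `A` and `T`, and the graph -/

section SL2

variable (p : ℕ) (k : Type u) [Field k] [CharP k p]

/-- The group `SL₂(𝔽_p)`. -/
abbrev SL2 (p : ℕ) : Type := Matrix.SpecialLinearGroup (Fin 2) (ZMod p)

/-- The substitution `f(X, Y) ↦ f(aX + cY, bX + dY)` given by a matrix `(a b; c d)` over `𝔽_p`,
where `X` and `Y` are the variables numbered `0` and `1`. -/
def subst (M : Matrix (Fin 2) (Fin 2) (ZMod p)) :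
    MvPolynomial (Fin 2) k →ₐ[k] MvPolynomial (Fin 2) k :=
  MvPolynomial.aeval fun j =>
    ∑ i, MvPolynomial.C (ZMod.castHom (dvd_refl p) k (M i j)) * MvPolynomial.X i

theorem subst_one : subst p k 1 = AlgHom.id k _ := by
  refine MvPolynomial.algHom_ext fun j => ?_
  fin_cases j <;> simp [subst, Fin.sum_univ_two]

theorem subst_mul (M N : Matrix (Fin 2) (Fin 2) (ZMod p)) :
    subst p k (M * N) = (subst p k M).comp (subst p k N) := by
  refine MvPolynomial.algHom_ext fun j => ?_
  simp only [subst, Fin.sum_univ_two, Matrix.mul_apply, AlgHom.comp_apply,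
    MvPolynomial.aeval_X, map_add, map_mul, MvPolynomial.algHom_C, MvPolynomial.algebraMap_eq]
  ring

theorem subst_mem (M : Matrix (Fin 2) (Fin 2) (ZMod p)) (d : ℕ) :
    ∀ f ∈ MvPolynomial.homogeneousSubmodule (Fin 2) k d,
      (subst p k M).toLinearMap f ∈ MvPolynomial.homogeneousSubmodule (Fin 2) k d := by
  intro f hf
  rw [MvPolynomial.mem_homogeneousSubmodule] at hf ⊢
  have := hf.aeval (n := 1)
    (fun j : Fin 2 => ∑ i, MvPolynomial.C (ZMod.castHom (dvd_refl p) k (M i j)) *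
      (MvPolynomial.X i : MvPolynomial (Fin 2) k))
    (fun j => MvPolynomial.IsHomogeneous.sum _ _ _ fun i _ => by
      simpa using (MvPolynomial.isHomogeneous_C (Fin 2) (ZMod.castHom (dvd_refl p) k (M i j))).mul
        (MvPolynomial.isHomogeneous_X k i))
  simpa [subst] using this

instance (d : ℕ) : Module.Finite k (MvPolynomial.homogeneousSubmodule (Fin 2) k d) :=
  Module.Finite.iff_fg.2 (MvPolynomial.homogeneousSubmodule_fg _ _ d)

/-- The module `V_n`, for `n ≥ 1`: homogeneous polynomials of degree `n - 1` in two variables,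
on which `SL₂(𝔽_p)` acts by linear substitutions. -/
def V (n : ℕ) :
    Representation k (SL2 p) (MvPolynomial.homogeneousSubmodule (Fin 2) k (n - 1)) where
  toFun g := (subst p k g.1).toLinearMap.restrict (subst_mem p k g.1 (n - 1))
  map_one' := by
    ext f : 2
    simp [subst_one]
  map_mul' g h := by
    ext f : 2
    simp [subst_mul]

/-- The tensor product `V_i ⊗ V_j`. -/
abbrev VV (i j : ℕ) :
    Representation k (SL2 p) (MvPolynomial.homogeneousSubmodule (Fin 2) k (i - 1) ⊗[k]
      MvPolynomial.homogeneousSubmodule (Fin 2) k (j - 1)) :=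
  (V p k i).tprod (V p k j)

/-- The index set `[p - 1] = {1, …, p - 1}`. -/
abbrev Idx (p : ℕ) : Type := Set.Icc 1 (p - 1)

/-- The matrix `A⁽ⁿ⁾`, whose `(i, j)` entry is the multiplicity of `V_j` as a direct summand of
`V_i ⊗ V_n`. -/
def A (n : ℕ) : Matrix (Idx p) (Idx p) ℕ :=
  Matrix.of fun i j => summandMultiplicity (V p k j) (VV p k i n)

/-- The matrix `T`, with ones on the antidiagonal and zeros elsewhere. -/
def T (p : ℕ) : Matrix (Idx p) (Idx p) ℕ :=
  Matrix.of fun i j => if (i : ℕ) + j = p then 1 else 0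

/-- The graph (with loops) on `[p - 1]` with adjacency matrix `A⁽ⁿ⁾` (whose entries are all
`0` or `1`). -/
def graph (n : ℕ) : Digraph (Idx p) where
  Adj i j := A p k n i j ≠ 0

/-- The subgraph of a graph induced on a set of vertices. -/
def inducedSubgraph {X : Type*} (Γ : Digraph X) (s : Set X) : Digraph s where
  Adj x y := Γ.Adj x y

/-- The module `V_n` as an object of the category of finite-dimensional modules. -/
abbrev VObj (n : ℕ) : FDRep k (SL2 p) := FDRep.of (V p k n)

/-- The coset `[M] + 𝔭` in `G₀(kG)/𝔭`, where `G = SL₂(𝔽_p)` and `𝔭` is generated by the classes of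
projective modules. -/
def coset (M : FDRep k (SL2 p)) : G0 k (SL2 p) ⧸ projIdeal k (SL2 p) :=
  Ideal.Quotient.mk (projIdeal k (SL2 p)) (cls M)

end SL2

end SL2Rep

end

/-! Everything takes place in the stable category, where two intertwining maps are identified when
they differ by a relative trace `∑ g, g φ g⁻¹`. By Higman's criterion
(`isProjective_iff_isTrace_id`) the projective modules are exactly the objects that become zero
there. The heart of the matter is that `V_{p-1}` acts as the reflection `n ↦ p - n`: `V_{p-1} ⊗ V_n`
is stably isomorphic to `V_{p-n}` (`stableIso_symRep_aux`). For `n = 2` this is the Clebsch-Gordan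
splitting `V_{p-1} ⊗ V_2 ≅ V_p ⊕ V_{p-2}` together with the projectivity of the Steinberg module
`V_p`. For larger `n` one tensors `V_n ⊗ V_2 ≅ V_{n+1} ⊕ V_{n-1}` with `V_{p-1}` and cancels the
summand already known; cancellation is legitimate because that summand is simple, so its nonzero
endomorphisms are invertible (`Splits.cancel`).

It follows that `V_i ⊗ V_j ~ V_i ⊗ V_{p-1} ⊗ V_{p-j} ~ V_{p-i} ⊗ V_{p-j}` stably (`stableIso_VV`). A
stable isomorphism gives isomorphic projective-free parts, by Fitting's lemma, and hence equal
classes modulo the ideal of projectives.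

Multiplicities are stable invariants too. For `j < p` the module `V_j` is simple of dimension prime
to `p`, so no nonzero endomorphism of it is a relative trace (`symRep_isTrace_eq_zero`), and being a
summand `m` times can be tested stably. Tensoring with `V_{p-1}` also carries summands `V_j` of `V_i
⊗ V_n` to summands `V_{p-j}` of `V_{p-i} ⊗ V_n`. These two symmetries give the matrix and graph
statements.

On the Grothendieck group modulo projectives, `ρ` is multiplication by the class of `V_{p-1}`, whose
square is `1`. Uniqueness requires the classes of `V_1, …, V_{p-1}` to generate, and this holds
because every nonzero module contains some `V_n` with `n ≤ p` (`VFree.eq_zero`): functions on the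
group are polynomials in the matrix entries, and tensor products with `V_2` are controlled by the
Koszul and polarization maps. -/

noncomputable section

namespace SL2Rep

open scoped TensorProduct MonoidAlgebra
open Representation

/-! ### Relative traces and projectivity -/

section Trace

variable {k : Type*} [Field k] {G : Type*} [Group G] [Fintype G]
variable {V : Type*} [AddCommGroup V] [Module k V] {ρ : Representation k G V}
variable {W : Type*} [AddCommGroup W] [Module k W] {σ : Representation k G W}
variable {U : Type*} [AddCommGroup U] [Module k U] {τ : Representation k G U}

/-- The sum of the conjugates of a linear map, as an intertwining map. -/
def relTrace (ρ : Representation k G V) (σ : Representation k G W) (φ : V →ₗ[k] W) :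
    ρ.IntertwiningMap σ where
  toLinearMap := ∑ g, σ g ∘ₗ φ ∘ₗ ρ g⁻¹
  isIntertwining' h := by
    ext v
    simp only [LinearMap.comp_apply, LinearMap.sum_apply, map_sum]
    refine Fintype.sum_equiv (Equiv.mulLeft h⁻¹) _ _ fun g => ?_
    rw [Equiv.coe_mulLeft, ← Module.End.mul_apply (σ h), ← map_mul, mul_inv_cancel_left,
      ← Module.End.mul_apply (ρ g⁻¹), ← map_mul, mul_inv_rev, inv_inv]

theorem relTrace_apply (φ : V →ₗ[k] W) (v : V) :
    relTrace ρ σ φ v = ∑ g, σ g (φ (ρ g⁻¹ v)) := by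
  change (∑ g, σ g ∘ₗ φ ∘ₗ ρ g⁻¹) v = _
  simp

/-- `f` is the relative trace of a linear map. By Higman's criterion, these are the intertwining
maps that factor through a projective representation. -/
def IsTrace (f : ρ.IntertwiningMap σ) : Prop := ∃ φ, relTrace ρ σ φ = f

theorem IsTrace.congr {f g : ρ.IntertwiningMap σ} (hf : IsTrace f) (h : ∀ v, g v = f v) :
    IsTrace g := (DFunLike.ext g f h) ▸ hf

theorem IsTrace.zero : IsTrace (0 : ρ.IntertwiningMap σ) :=
  ⟨0, DFunLike.ext _ _ fun v => by rw [relTrace_apply]; simp⟩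

theorem IsTrace.add {f g : ρ.IntertwiningMap σ} (hf : IsTrace f) (hg : IsTrace g) :
    IsTrace (f + g) := by
  obtain ⟨φ, rfl⟩ := hf
  obtain ⟨ψ, rfl⟩ := hg
  exact ⟨φ + ψ, DFunLike.ext _ _ fun v => by
    simp [relTrace_apply, Finset.sum_add_distrib]⟩

theorem IsTrace.neg {f : ρ.IntertwiningMap σ} (hf : IsTrace f) : IsTrace (-f) := by
  obtain ⟨φ, rfl⟩ := hf
  exact ⟨-φ, DFunLike.ext _ _ fun v => by
    rw [relTrace_apply, IntertwiningMap.coe_neg, Pi.neg_apply, relTrace_apply]; simp⟩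

theorem IsTrace.comp_left {f : ρ.IntertwiningMap σ} (hf : IsTrace f) (a : σ.IntertwiningMap τ) :
    IsTrace (a.comp f) := by
  obtain ⟨φ, rfl⟩ := hf
  exact ⟨a.toLinearMap ∘ₗ φ, DFunLike.ext _ _ fun v => by
    simp [relTrace_apply, a.isIntertwining]⟩

theorem IsTrace.comp_right {f : ρ.IntertwiningMap σ} (hf : IsTrace f) (a : τ.IntertwiningMap ρ) :
    IsTrace (f.comp a) := by
  obtain ⟨φ, rfl⟩ := hf
  exact ⟨φ ∘ₗ a.toLinearMap, DFunLike.ext _ _ fun v => by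
    simp [relTrace_apply, a.isIntertwining]⟩

/-- Conjugating `id ⊗ φ` by `g` changes only the second factor, so its relative trace is `id ⊗ Tr
φ`. This makes tensoring well defined on the stable category. -/
theorem IsTrace.lTensor (τ : Representation k G U) {f : ρ.IntertwiningMap σ} (hf : IsTrace f) :
    IsTrace (IntertwiningMap.lTensor τ f) := by
  obtain ⟨φ, rfl⟩ := hf
  refine ⟨φ.lTensor U, IntertwiningMap.ext <| TensorProduct.ext' fun u v => ?_⟩
  simp [IntertwiningMap.toLinearMap_apply, relTrace_apply, TensorProduct.tmul_sum,
    ← Module.End.mul_apply, ← map_mul]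

-- On a free module, the projection to the coefficient of the identity of `G` has relative trace the
-- identity. A projective module inherits this through a section of its canonical free cover.
omit [Fintype G] in
theorem exists_sum_conj_eq_of_projective [Fintype G] (M : Type*) [AddCommGroup M] [Module k M]
    [Module k[G] M]
    [IsScalarTower k k[G] M] [Module.Projective k[G] M] :
    ∃ φ : M →ₗ[k] M, ∀ m, ∑ g : G, MonoidAlgebra.single g (1 : k) •
      φ (MonoidAlgebra.single g⁻¹ (1 : k) • m) = m := by
  obtain ⟨s, hs⟩ := (Module.projective_def' (R := k[G]) (P := M)).1 ‹_›
  let ε : k[G] →ₗ[k] k :=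
    { toFun := fun x => x.coeff 1
      map_add' := fun x y => by simp
      map_smul' := fun x y => by simp }
  let ψ : (M →₀ k[G]) →ₗ[k] M :=
    Finsupp.lsum k fun m => (LinearMap.toSpanSingleton k M m).comp ε
  have hψ : ∀ m x, ψ (Finsupp.single m x) = x.coeff 1 • m := fun m x => by
    simp [ψ, ε]
    rfl
  have key : ∀ x : M →₀ k[G],
      ∑ g : G, MonoidAlgebra.single g (1 : k) • (ψ (MonoidAlgebra.single g⁻¹ (1 : k) • x)) =
        Finsupp.linearCombination k[G] id x := by
    intro x
    induction x using Finsupp.induction_linear with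
    | zero => simp
    | add x y hx hy => simp only [smul_add, map_add, Finset.sum_add_distrib, hx, hy]
    | single m a =>
      simp only [Finsupp.smul_single, hψ, Finsupp.linearCombination_single, id]
      induction a using MonoidAlgebra.induction_linear with
      | zero => simp
      | add x y hx hy =>
        rw [add_smul, ← hx, ← hy, ← Finset.sum_add_distrib]
        refine Finset.sum_congr rfl fun g _ => ?_
        rw [smul_add, MonoidAlgebra.coeff_add, Finsupp.add_apply, add_smul, smul_add]
      | single h a =>
        -- The coefficient at `1` of `g⁻¹ h` vanishes unless `g = h`.
        rw [Finset.sum_eq_single h]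
        · simp only [smul_eq_mul, MonoidAlgebra.single_mul_single, inv_mul_cancel, one_mul]
          rw [MonoidAlgebra.coeff_single, Finsupp.single_eq_same, ← smul_comm, ← smul_assoc]
          simp
        · intro g _ hg
          have : g⁻¹ * h ≠ 1 := fun e => hg (inv_mul_eq_one.1 e)
          simp [MonoidAlgebra.single_mul_single, this]
        · simp
  refine ⟨ψ ∘ₗ s.restrictScalars k, fun m => ?_⟩
  refine Eq.trans ?_ ((key (s m)).trans (LinearMap.congr_fun hs m))
  simp

/-- Higman's criterion. -/
theorem isProjective_iff_isTrace_id :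
    IsProjective ρ ↔ IsTrace (IntertwiningMap.id ρ) := by
  constructor
  · intro h
    have : Module.Projective k[G] ρ.asModule := h
    obtain ⟨φ, hφ⟩ := exists_sum_conj_eq_of_projective (k := k) (G := G) ρ.asModule
    refine ⟨ρ.asModuleEquiv.toLinearMap ∘ₗ φ ∘ₗ ρ.asModuleEquiv.symm.toLinearMap,
      DFunLike.ext _ _ fun v => ?_⟩
    rw [relTrace_apply, IntertwiningMap.id_apply]
    refine Eq.trans (Finset.sum_congr rfl fun g _ => ?_) (hφ (ρ.asModuleEquiv.symm v))
    rw [Representation.single_smul, Representation.single_smul, one_smul, one_smul]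
    rfl
  · rintro ⟨φ, hφ⟩
    refine Module.Projective.of_lifting_property'' fun f hf => ?_
    let τ : Representation k G (ρ.asModule →₀ k[G]) := Representation.ofModule' _
    have hτ : ∀ (g : G) (x : ρ.asModule →₀ k[G]),
        τ g x = MonoidAlgebra.single g (1 : k) • x := fun g x => by
      simp [τ, Representation.ofModule']
    let fk : τ.IntertwiningMap ρ :=
      { toFun := fun x => f x
        map_add' := fun x y => map_add f x y
        map_smul' := fun c x => by
          rw [RingHom.id_apply, ← algebraMap_smul k[G] c x, map_smul]
          change (algebraMap k k[G] c) • f x = _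
          rw [MonoidAlgebra.coe_algebraMap, Function.comp_apply, Algebra.algebraMap_self_apply,
            Representation.single_smul, map_one]
          rfl
        isIntertwining' := fun g => LinearMap.ext fun x => by
          change f (τ g x) = ρ g (f x)
          rw [hτ, map_smul, Representation.single_smul, one_smul]
          rfl }
    obtain ⟨s, hs⟩ := fk.toLinearMap.exists_rightInverse_of_surjective (LinearMap.range_eq_top.2 hf)
    have hs' : ∀ x, fk (s x) = x := fun x => LinearMap.congr_fun hs x
    -- Averaging makes the linear section equivariant: `fk ∘ Tr(s φ) = Tr(fk s φ) = Tr φ = id`.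
    let K := relTrace ρ τ (s ∘ₗ φ)
    have hK : fk.comp K = IntertwiningMap.id ρ := by
      rw [← hφ]
      refine DFunLike.ext _ _ fun v => ?_
      simp [K, relTrace_apply, fk.isIntertwining, hs']
    let K' := IntertwiningMap.equivLinearMapAsModule _ _ K
    let I : τ.asModule →ₗ[k[G]] (ρ.asModule →₀ k[G]) :=
      { toFun := fun x => x
        map_add' := fun _ _ => rfl
        map_smul' := fun m x => by
          rw [RingHom.id_apply]
          change τ.asAlgebraHom m x = _
          have : τ.asAlgebraHom = Algebra.lsmul k k _ :=
            (MonoidAlgebra.lift k (Module.End k _) G).apply_symm_apply _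
          rw [this]
          rfl }
    exact ⟨I.comp K', LinearMap.ext fun x => DFunLike.congr_fun hK x⟩

end Trace

/-! ### Complements and projective-free parts -/

section Complement

variable {k : Type*} [Field k] {G : Type*} [Group G]
variable {V : Type*} [AddCommGroup V] [Module k V] {ρ : Representation k G V}
variable {W : Type*} [AddCommGroup W] [Module k W] {σ : Representation k G W}

/-- The inclusion of a subrepresentation. -/
def incl (S : Subrepresentation ρ) : S.toRepresentation.IntertwiningMap ρ where
  toLinearMap := S.toSubmodule.subtype
  isIntertwining' _ := rfl

@[simp]
theorem incl_apply (S : Subrepresentation ρ) (x : S.toSubmodule) : incl S x = x := rfl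

theorem isCompl_toSubmodule_iff {S S' : Subrepresentation ρ} :
    IsCompl S S' ↔ IsCompl S.toSubmodule S'.toSubmodule := by
  rw [isCompl_iff, isCompl_iff, disjoint_iff, disjoint_iff, codisjoint_iff, codisjoint_iff,
    ← Subrepresentation.toSubmodule_injective.eq_iff,
    ← Subrepresentation.toSubmodule_injective.eq_iff]
  rfl

/-- The projection onto a subrepresentation along a complement. -/
def proj {S S' : Subrepresentation ρ} (h : IsCompl S S') :
    ρ.IntertwiningMap S.toRepresentation where
  toLinearMap := S.toSubmodule.projectionOnto S'.toSubmodule (isCompl_toSubmodule_iff.1 h)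
  isIntertwining' g := by
    have h' := isCompl_toSubmodule_iff.1 h
    ext v
    obtain ⟨s, t, rfl, -⟩ := Submodule.existsUnique_add_of_isCompl h' v
    have h1 : ρ g s ∈ S.toSubmodule := S.apply_mem_toSubmodule g s.2
    have h2 : ρ g t ∈ S'.toSubmodule := S'.apply_mem_toSubmodule g t.2
    simp only [LinearMap.comp_apply, map_add, Submodule.projectionOnto_apply_left,
      Submodule.projectionOnto_apply_right, add_zero, map_zero]
    rw [Submodule.projectionOnto_apply_of_mem_left h' h1,
      (Submodule.projectionOnto_apply_eq_zero_iff h').2 h2, add_zero]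
    rfl

theorem proj_apply_coe {S S' : Subrepresentation ρ} (h : IsCompl S S') (x : S.toSubmodule) :
    proj h (x : V) = x :=
  Submodule.projectionOnto_apply_left _ x

theorem proj_eq_zero_iff {S S' : Subrepresentation ρ} (h : IsCompl S S') (x : V) :
    proj h x = 0 ↔ x ∈ S'.toSubmodule :=
  Submodule.projectionOnto_apply_eq_zero_iff _

theorem proj_surjective {S S' : Subrepresentation ρ} (h : IsCompl S S') :
    Function.Surjective (proj h) := fun x => ⟨x, proj_apply_coe h x⟩

theorem proj_add_proj {S S' : Subrepresentation ρ} (h : IsCompl S S') (x : V) :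
    (proj h x : V) + (proj h.symm x : V) = x := by
  obtain ⟨s, t, rfl, -⟩ := Submodule.existsUnique_add_of_isCompl (isCompl_toSubmodule_iff.1 h) x
  rw [map_add, map_add, proj_apply_coe, proj_apply_coe, (proj_eq_zero_iff h _).2 t.2,
    (proj_eq_zero_iff h.symm _).2 s.2]
  simp

theorem isCompl_range_ker {e : ρ.IntertwiningMap ρ} (he : ∀ x, e (e x) = e x) :
    IsCompl e.range e.ker := by
  rw [isCompl_toSubmodule_iff]
  exact (LinearMap.IsIdempotentElem.isCompl (f := e.toLinearMap) (LinearMap.ext he))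

/-- The retract form of being a summand, which makes sense in any additive category and so can be
compared with its stable version. -/
theorem isSummand_iff_exists {σ : Representation k G W} :
    IsSummand σ ρ ↔ ∃ (a : σ.IntertwiningMap ρ) (b : ρ.IntertwiningMap σ), ∀ x, b (a x) = x := by
  constructor
  · rintro ⟨S, S', h, ⟨e⟩⟩
    refine ⟨(incl S).comp e.toIntertwiningMap, e.symm.toIntertwiningMap.comp (proj h), fun x => ?_⟩
    change e.symm (proj h (e x : V)) = x
    rw [proj_apply_coe]
    exact e.symm_apply_apply x
  · rintro ⟨a, b, hab⟩
    refine ⟨a.range, b.ker, ?_, ⟨?_⟩⟩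
    · rw [isCompl_toSubmodule_iff]
      refine ⟨Submodule.disjoint_def.2 ?_, codisjoint_iff.2 (eq_top_iff.2 fun x _ => ?_)⟩
      · rintro _ ⟨x, rfl⟩ h
        have h : b (a x) = 0 := h
        rw [hab] at h
        rw [h, map_zero]
      · refine Submodule.mem_sup.2 ⟨a (b x), ⟨b x, rfl⟩, x - a (b x), ?_, add_sub_cancel _ _⟩
        change b _ = 0
        rw [map_sub, hab, sub_self]
    · exact Representation.Equiv.mk (LinearEquiv.ofInjective a.toLinearMap fun x y h => by
        rw [← hab x, ← hab y]; exact congrArg b h) fun g => by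
          ext x
          exact a.isIntertwining _ _ g x

end Complement

/-! ### Fitting's lemma and uniqueness of projective-free parts -/

section ProjectiveFree

variable {k : Type*} [Field k] {G : Type*} [Group G] [Fintype G]
variable {V : Type*} [AddCommGroup V] [Module k V] {ρ : Representation k G V}
variable {W : Type*} [AddCommGroup W] [Module k W] {σ : Representation k G W}
variable {U : Type*} [AddCommGroup U] [Module k U] {τ : Representation k G U}

/-- If a bijective endomorphism is a relative trace, then the representation is projective. -/
theorem isProjective_of_bijective {f : ρ.IntertwiningMap ρ} (hf : IsTrace f)
    (hb : Function.Bijective f) : IsProjective ρ := by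
  rw [isProjective_iff_isTrace_id]
  exact (hf.comp_left (f.ofBijective hb).symm.toIntertwiningMap).congr fun v =>
    ((f.ofBijective hb).symm_apply_apply v).symm

/-- Fitting's lemma: a relative trace on a projective-free representation is nilpotent. -/
theorem IsProjectiveFree.isNilpotent [FiniteDimensional k V] (hρ : IsProjectiveFree ρ)
    {f : ρ.IntertwiningMap ρ} (hf : IsTrace f) : IsNilpotent f.toLinearMap := by
  obtain ⟨n, hn⟩ := Filter.eventually_atTop.1 f.toLinearMap.eventually_isCompl_ker_pow_range_pow
  -- The exponent must be positive: `f ^ 0` is the identity, which need not be a relative trace.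
  have hn := hn (n + 1) n.le_succ
  let F : ρ.IntertwiningMap ρ := f ^ (n + 1)
  have hF : F.toLinearMap = f.toLinearMap ^ (n + 1) :=
    map_pow ({ toFun := fun x => x.toLinearMap, map_one' := rfl, map_mul' := fun _ _ => rfl } :
      ρ.IntertwiningMap ρ →* Module.End k V) f (n + 1)
  have hFt : IsTrace F := by
    have : F = (f ^ n : ρ.IntertwiningMap ρ).comp f := pow_succ f n
    rw [this]
    exact hf.comp_left _
  have hc : IsCompl F.range F.ker := by
    rw [isCompl_toSubmodule_iff]
    change IsCompl (LinearMap.range F.toLinearMap) (LinearMap.ker F.toLinearMap)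
    rw [hF]
    exact hn.symm
  -- `F` restricts to a bijective relative trace on its own range. The range is therefore a
  -- projective summand, hence zero.
  have hinj : Function.Injective (((proj hc).comp F).comp (incl F.range)) := by
    rw [injective_iff_map_eq_zero]
    intro x hx
    have h1 : F (x : V) ∈ F.range.toSubmodule := ⟨x, rfl⟩
    have h2 : F (x : V) ∈ F.ker.toSubmodule := (proj_eq_zero_iff hc _).1 hx
    have h3 : F (x : V) = 0 :=
      Submodule.disjoint_def.1 (isCompl_toSubmodule_iff.1 hc).disjoint _ h1 h2
    exact Subtype.ext (Submodule.disjoint_def.1 (isCompl_toSubmodule_iff.1 hc).disjoint _ x.2 h3)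
  have hbot := hρ _ _ hc <| isProjective_of_bijective ((hFt.comp_left _).comp_right _)
    ⟨hinj, LinearMap.injective_iff_surjective (f := (((proj hc).comp F).comp
      (incl F.range)).toLinearMap).1 hinj⟩
  refine ⟨n + 1, ?_⟩
  rw [← hF]
  exact LinearMap.range_eq_bot.1 (congrArg Subrepresentation.toSubmodule hbot)

/-- `ρ` and `σ` are isomorphic up to relative traces, that is, in the stable category. -/
def StableIso (ρ : Representation k G V) (σ : Representation k G W) : Prop :=
  ∃ (a : ρ.IntertwiningMap σ) (b : σ.IntertwiningMap ρ),
    IsTrace (b.comp a - IntertwiningMap.id ρ) ∧ IsTrace (a.comp b - IntertwiningMap.id σ)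

theorem StableIso.symm (h : StableIso ρ σ) : StableIso σ ρ :=
  let ⟨a, b, hba, hab⟩ := h
  ⟨b, a, hab, hba⟩

/-- Write `b d c a - 1 = b (d c - 1) a + (b a - 1)`. -/
theorem isTrace_comp_sub_id {a : ρ.IntertwiningMap σ} {b : σ.IntertwiningMap ρ}
    {c : σ.IntertwiningMap τ} {d : τ.IntertwiningMap σ}
    (h : IsTrace (b.comp a - IntertwiningMap.id ρ))
    (h' : IsTrace (d.comp c - IntertwiningMap.id σ)) :
    IsTrace ((b.comp d).comp (c.comp a) - IntertwiningMap.id ρ) := by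
  refine (((h'.comp_left b).comp_right a).add h).congr fun v => ?_
  simp [IntertwiningMap.coe_sub]

theorem StableIso.trans (h : StableIso ρ σ) (h' : StableIso σ τ) : StableIso ρ τ :=
  let ⟨a, b, hba, hab⟩ := h
  let ⟨c, d, hdc, hcd⟩ := h'
  ⟨c.comp a, b.comp d, isTrace_comp_sub_id hba hdc, isTrace_comp_sub_id hcd hab⟩

theorem StableIso.of_equiv (e : ρ.Equiv σ) : StableIso ρ σ := by
  refine ⟨e.toIntertwiningMap, e.symm.toIntertwiningMap, ?_, ?_⟩
  · refine IsTrace.zero.congr fun v => ?_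
    simp [IntertwiningMap.coe_sub]
  · refine IsTrace.zero.congr fun v => ?_
    simp [IntertwiningMap.coe_sub]

/-- By Fitting's lemma such an `f` is the identity plus a nilpotent map. -/
theorem IsProjectiveFree.bijective_of_isTrace [FiniteDimensional k V] (hρ : IsProjectiveFree ρ)
    {f : ρ.IntertwiningMap ρ} (hf : IsTrace (f - IntertwiningMap.id ρ)) :
    Function.Bijective f := by
  have h := (hρ.isNilpotent hf).isUnit_add_one
  have : (f - IntertwiningMap.id ρ).toLinearMap + 1 = f.toLinearMap := by
    ext x; simp
  rw [this] at h
  exact (Module.End.isUnit_iff _).1 h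

theorem IsProjectiveFree.nonempty_equiv [FiniteDimensional k V] [FiniteDimensional k W]
    (hρ : IsProjectiveFree ρ) (hσ : IsProjectiveFree σ) (h : StableIso ρ σ) :
    Nonempty (ρ.Equiv σ) := by
  obtain ⟨a, b, hba, hab⟩ := h
  refine ⟨a.ofBijective ⟨?_, ?_⟩⟩
  · exact Function.Injective.of_comp (f := b) (hρ.bijective_of_isTrace hba).1
  · exact Function.Surjective.of_comp (g := b) (hσ.bijective_of_isTrace hab).2

/-- The identity of `Q` is a relative trace, so the projection onto `Q` vanishes stably. -/
theorem stableIso_of_isCompl {S Q : Subrepresentation ρ} (h : IsCompl S Q)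
    (hQ : IsProjective Q.toRepresentation) : StableIso S.toRepresentation ρ := by
  refine ⟨incl S, proj h, ?_, ?_⟩
  · refine IsTrace.zero.congr fun v => ?_
    simp [IntertwiningMap.coe_sub, proj_apply_coe]
  · refine (((isProjective_iff_isTrace_id.1 hQ).comp_left (incl Q)).comp_right
      (proj h.symm)).neg.congr fun v => ?_
    change (proj h v : V) - v = -(proj h.symm v : V)
    rw [sub_eq_iff_eq_add, neg_add_eq_sub, eq_sub_iff_add_eq, proj_add_proj]

theorem exists_isProjectiveFreePart [FiniteDimensional k V] (ρ : Representation k G V) :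
    ∃ S, IsProjectiveFreePart ρ S := by
  -- Projective summands are moved from `S` into its projective complement until none is left; the
  -- dimension of `S` drops each time.
  suffices H : ∀ (n : ℕ) (S Q : Subrepresentation ρ), IsCompl S Q →
      IsProjective Q.toRepresentation → Module.finrank k S.toSubmodule ≤ n →
      ∃ S, IsProjectiveFreePart ρ S by
    refine H _ ⊤ ⊥ isCompl_top_bot ?_ le_rfl
    rw [isProjective_iff_isTrace_id]
    refine IsTrace.zero.congr fun v => ?_
    exact Subtype.ext ((Submodule.mem_bot k).1 v.2)
  intro n
  induction n with
  | zero =>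
    intro S Q h hQ hn
    refine ⟨S, fun S1 S2 _ _ => ?_, Q, h, hQ⟩
    have : Subsingleton S.toSubmodule := Module.finrank_zero_iff.1 (Nat.le_zero.1 hn)
    exact Subrepresentation.toSubmodule_injective (Subsingleton.elim _ _)
  | succ n ih =>
    intro S Q h hQ hn
    by_cases hS : IsProjectiveFree S.toRepresentation
    · exact ⟨S, hS, Q, h, hQ⟩
    unfold IsProjectiveFree at hS
    push Not at hS
    obtain ⟨S1, S2, h12, hS1, hne⟩ := hS
    -- The idempotent with image `S2` and kernel `S1 ⊕ Q`. Since `1 - e` factors through the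
    -- projectives `S1` and `Q`, it is a relative trace, and this makes the kernel of `e`
    -- projective.
    let e : ρ.IntertwiningMap ρ := (((incl S).comp (incl S2)).comp (proj h12.symm)).comp (proj h)
    have he : ∀ x, e x = ((proj h12.symm (proj h x) : S.toSubmodule) : V) := fun x => rfl
    have hee : ∀ x, e (e x) = e x := fun x => by
      rw [he x, he, proj_apply_coe h, proj_apply_coe h12.symm]
    have ht : IsTrace (IntertwiningMap.id ρ - e) := by
      refine ((((isProjective_iff_isTrace_id.1 hQ).comp_left (incl Q)).comp_right
        (proj h.symm)).add (((isProjective_iff_isTrace_id.1 hS1).comp_left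
          ((incl S).comp (incl S1))).comp_right ((proj h12).comp (proj h)))).congr fun v => ?_
      change v - ((proj h12.symm (proj h v) : S.toSubmodule) : V) =
        (proj h.symm v : V) + ((proj h12 (proj h v) : S.toSubmodule) : V)
      rw [sub_eq_iff_eq_add, add_assoc, ← Submodule.coe_add, proj_add_proj, add_comm,
        proj_add_proj]
    refine ih e.range e.ker (isCompl_range_ker hee) ?_ ?_
    · rw [isProjective_iff_isTrace_id]
      refine ((ht.comp_left (proj (isCompl_range_ker hee).symm)).comp_right
        (incl e.ker)).congr fun v => ?_
      have hv : e v = 0 := v.2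
      simp [IntertwiningMap.coe_sub, hv, proj_apply_coe]
    · have h1 : Module.finrank k e.range.toSubmodule ≤ Module.finrank k S2.toSubmodule := by
        have : e.range.toSubmodule ≤ S2.toSubmodule.map S.toSubmodule.subtype := by
          rintro _ ⟨x, rfl⟩
          exact ⟨proj h12.symm (proj h x), (proj h12.symm (proj h x)).2, rfl⟩
        exact (Submodule.finrank_mono this).trans (Submodule.finrank_map_le _ _)
      have h2 := Submodule.finrank_add_eq_of_isCompl (isCompl_toSubmodule_iff.1 h12)
      have h3 : 0 < Module.finrank k S1.toSubmodule := by
        rw [Nat.pos_iff_ne_zero, Ne, Submodule.finrank_eq_zero]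
        exact fun h => hne (Subrepresentation.toSubmodule_injective h)
      omega

theorem StableIso.projectiveFreePartsIso [FiniteDimensional k V] [FiniteDimensional k W]
    (h : StableIso ρ σ) : ProjectiveFreePartsIso ρ σ := by
  refine ⟨exists_isProjectiveFreePart ρ, exists_isProjectiveFreePart σ, ?_⟩
  rintro S S' ⟨hS, Q, hQ, hQp⟩ ⟨hS', Q', hQ', hQp'⟩
  exact hS.nonempty_equiv hS'
    (((stableIso_of_isCompl hQ hQp).trans h).trans (stableIso_of_isCompl hQ' hQp').symm)

end ProjectiveFree

/-! ### Classes of stably isomorphic modules -/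

section Class

universe u v

variable {k : Type u} [Field k] {G : Type v} [Group G]

theorem cls_eq_add_of_isCompl {M : FDRep k G} {S S' : Subrepresentation M.rep}
    (h : IsCompl S S') :
    cls M = cls (FDRep.of S.toRepresentation) + cls (FDRep.of S'.toRepresentation) := by
  refine cls_exact (U := FDRep.of S.toRepresentation) (V := FDRep.of S'.toRepresentation)
    (incl S) (proj h.symm) Subtype.val_injective (fun x => ?_) (proj_surjective _)
  refine (proj_eq_zero_iff h.symm x).trans ?_
  exact ⟨fun hx => ⟨⟨x, hx⟩, rfl⟩, by rintro ⟨y, rfl⟩; exact y.2⟩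

/-- The isomorphic projective-free parts cancel, leaving a difference of two classes of projectives.
-/
theorem StableIso.cls_sub_mem [Fintype G] {M N : FDRep k G} (h : StableIso M.rep N.rep) :
    cls M - cls N ∈ projIdeal k G := by
  obtain ⟨⟨S, hS⟩, ⟨S', hS'⟩, H⟩ := h.projectiveFreePartsIso
  obtain ⟨e⟩ := H S S' hS hS'
  obtain ⟨-, Q, hQ, hQp⟩ := hS
  obtain ⟨-, Q', hQ', hQp'⟩ := hS'
  rw [cls_eq_add_of_isCompl hQ, cls_eq_add_of_isCompl hQ',
    cls_equiv (V := FDRep.of S.toRepresentation) (W := FDRep.of S'.toRepresentation) e,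
    add_sub_add_left_eq_sub]
  exact sub_mem (AddSubgroup.subset_closure ⟨FDRep.of Q.toRepresentation, hQp, rfl⟩ : _ ∈ projSubgroup k G)
    (AddSubgroup.subset_closure ⟨FDRep.of Q'.toRepresentation, hQp', rfl⟩)

end Class

/-! ### Cancellation in the stable category -/

section Cancellation

open CategoryTheory

universe u v w

/-- `X` is a biproduct of `A` and `B`. -/
def Splits {C : Type*} [Category* C] [Preadditive C] (X A B : C) : Prop :=
  ∃ (i : A ⟶ X) (p : X ⟶ A) (j : B ⟶ X) (q : X ⟶ B),
    i ≫ p = 𝟙 A ∧ j ≫ q = 𝟙 B ∧ i ≫ q = 0 ∧ j ≫ p = 0 ∧ p ≫ i + q ≫ j = 𝟙 X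

theorem Splits.map {C D : Type*} [Category* C] [Preadditive C] [Category* D] [Preadditive D]
    (F : C ⥤ D) [F.Additive] {X A B : C} (h : Splits X A B) :
    Splits (F.obj X) (F.obj A) (F.obj B) := by
  obtain ⟨i, p, j, q, h1, h2, h3, h4, h5⟩ := h
  refine ⟨F.map i, F.map p, F.map j, F.map q, ?_, ?_, ?_, ?_, ?_⟩
  · rw [← F.map_comp, h1, F.map_id]
  · rw [← F.map_comp, h2, F.map_id]
  · rw [← F.map_comp, h3, F.map_zero]
  · rw [← F.map_comp, h4, F.map_zero]
  · rw [← F.map_comp, ← F.map_comp, ← F.map_add, h5, F.map_id]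

variable {C : Type*} [Category* C] [Preadditive C] {X X' A B S S' : C}

theorem Splits.of_iso (h : Splits X A B) (e : X ≅ X') (f : B ≅ S) : Splits X' A S := by
  obtain ⟨i, p, j, q, h1, h2, h3, h4, h5⟩ := h
  refine ⟨i ≫ e.hom, e.inv ≫ p, f.inv ≫ j ≫ e.hom, e.inv ≫ q ≫ f.hom, ?_, ?_, ?_, ?_, ?_⟩
  · simp [h1]
  · simp [reassoc_of% h2]
  · simp [reassoc_of% h3]
  · simp [h4]
  · have : e.inv ≫ (p ≫ i + q ≫ j) ≫ e.hom = 𝟙 X' := by simp [h5]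
    simpa using this

/-- Regard the identity of `X` as a block matrix from `A ⊕ S` to `B ⊕ S`. When its `S`-`S` entry is
invertible, the Schur complement of that entry is an isomorphism from `A` to `B`; its inverse is the
corresponding entry `i' ≫ p` of the inverse matrix. -/
theorem Splits.nonempty_iso_of_isIso {i : A ⟶ X} {p : X ⟶ A} {j : S ⟶ X} {q : X ⟶ S}
    (h1 : i ≫ p = 𝟙 A) (h4 : j ≫ p = 0) (h5 : p ≫ i + q ≫ j = 𝟙 X)
    {i' : B ⟶ X} {p' : X ⟶ B} {j' : S ⟶ X} {q' : X ⟶ S}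
    (h1' : i' ≫ p' = 𝟙 B) (h3' : i' ≫ q' = 0) (h5' : p' ≫ i' + q' ≫ j' = 𝟙 X)
    (hd : IsIso (j ≫ q')) : Nonempty (A ≅ B) := by
  let d := inv (j ≫ q')
  have hd1 : j ≫ q' ≫ d = 𝟙 S := by
    rw [← Category.assoc]; exact IsIso.hom_inv_id (j ≫ q')
  have hd2 : d ≫ j ≫ q' = 𝟙 S := IsIso.inv_hom_id (j ≫ q')
  have e1 : p ≫ i = 𝟙 X - q ≫ j := eq_sub_of_add_eq h5
  have e2 : p' ≫ i' = 𝟙 X - q' ≫ j' := eq_sub_of_add_eq h5'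
  refine ⟨⟨i ≫ (𝟙 X - q' ≫ d ≫ j) ≫ p', i' ≫ p, ?_, ?_⟩⟩
  · simp only [Category.assoc]
    rw [reassoc_of% e2]
    simp only [Preadditive.sub_comp, Preadditive.comp_sub, Category.assoc, Category.id_comp,
      h1, h4, Limits.comp_zero, sub_zero, reassoc_of% hd2, sub_self]
  · rw [Category.assoc, reassoc_of% e1]
    simp only [Preadditive.sub_comp, Preadditive.comp_sub, Category.assoc, Category.id_comp,
      h1', reassoc_of% h3', Limits.zero_comp, reassoc_of% hd1]
    abel

/-- Cancellation of an object all of whose nonzero endomorphisms are isomorphisms. -/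
theorem Splits.cancel (h : Splits X A S) (h' : Splits X B S)
    (hS : ∀ f : S ⟶ S, f = 0 ∨ IsIso f) : Nonempty (A ≅ B) := by
  obtain ⟨i, p, j, q, h1, h2, h3, h4, h5⟩ := h
  obtain ⟨i', p', j', q', h1', h2', h3', h4', h5'⟩ := h'
  obtain hd | hd := hS (j ≫ q')
  · have e1 : p ≫ i = 𝟙 X - q ≫ j := eq_sub_of_add_eq h5
    -- If the `S`-`S` entry is zero, the first splitting is sheared by `j' ≫ p : S ⟶ A`. The new
    -- entry is `j' ≫ p ≫ i ≫ q' = j' ≫ (1 - q ≫ j) ≫ q' = 1`.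
    refine Splits.nonempty_iso_of_isIso (i := i) (p := p - q ≫ j' ≫ p) (q := q)
      (j := j + j' ≫ p ≫ i) ?_ ?_ ?_ h1' h3' h5' ?_
    · simp [h1, reassoc_of% h3]
    · simp [h1, h4, reassoc_of% h2, reassoc_of% h3]
    · simp [h5]
    · have : (j + j' ≫ p ≫ i) ≫ q' = 𝟙 S := by
        rw [Preadditive.add_comp, Category.assoc, Category.assoc, reassoc_of% e1]
        simp [hd, h2']
      rw [this]
      infer_instance
  · exact Splits.nonempty_iso_of_isIso h1 h4 h5 h1' h3' h5' hd

variable {k : Type u} [Field k] {G : Type v} [Group G] [Fintype G]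

/-- Two morphisms of representations are stably equal if they differ by a relative trace. -/
def stableRel (k : Type u) [Field k] (G : Type v) [Group G] [Fintype G] : HomRel (Rep.{w} k G) :=
  fun _ _ f g => IsTrace (f.hom - g.hom)

instance : Congruence (stableRel.{u, v, w} k G) where
  equivalence :=
    { refl f := IsTrace.zero.congr fun v => by simp
      symm {f g} h := IsTrace.congr (IsTrace.neg h) fun v => by
        simp [IntertwiningMap.coe_sub]
      trans {f g l} h h' := IsTrace.congr (IsTrace.add h h') fun v => by
        simp [IntertwiningMap.coe_sub] }
  comp_left f _ _ h := IsTrace.congr (IsTrace.comp_right h f.hom) fun v => by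
        simp [IntertwiningMap.coe_sub]
  comp_right f h := IsTrace.congr (IsTrace.comp_left h f.hom) fun v => by
        simp [IntertwiningMap.coe_sub]

/-- The stable category of representations. -/
abbrev StableCat (k : Type u) [Field k] (G : Type v) [Group G] [Fintype G] :=
  CategoryTheory.Quotient (stableRel.{u, v, w} k G)

theorem stableRel_add ⦃X Y : Rep.{w} k G⦄ (f f' g g' : X ⟶ Y) (h : stableRel k G f f')
    (h' : stableRel k G g g') : stableRel k G (f + g) (f' + g') :=
  IsTrace.congr (IsTrace.add h h') fun v => by
    simp only [Rep.add_hom, IntertwiningMap.coe_sub, IntertwiningMap.coe_add, Pi.sub_apply,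
      Pi.add_apply]
    abel

instance : Preadditive (StableCat.{u, v, w} k G) :=
  CategoryTheory.Quotient.preadditive _ stableRel_add

instance : (CategoryTheory.Quotient.functor (stableRel.{u, v, w} k G)).Additive :=
  CategoryTheory.Quotient.functor_additive _ stableRel_add

variable {V : Type w} [AddCommGroup V] [Module k V] {ρ : Representation k G V}
variable {V' : Type w} [AddCommGroup V'] [Module k V'] {ρ' : Representation k G V'}
variable {W : Type w} [AddCommGroup W] [Module k W] {σ : Representation k G W}
variable {W' : Type w} [AddCommGroup W'] [Module k W'] {σ' : Representation k G W'}
variable {U : Type w} [AddCommGroup U] [Module k U] {τ : Representation k G U}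
variable {U' : Type w} [AddCommGroup U'] [Module k U'] {τ' : Representation k G U'}

/-- The object of the stable category given by a representation. -/
abbrev stab (ρ : Representation k G V) : StableCat.{u, v, w} k G :=
  (CategoryTheory.Quotient.functor _).obj (Rep.of ρ)

theorem stableIso_iff : StableIso ρ σ ↔ Nonempty (stab ρ ≅ stab σ) := by
  constructor
  · rintro ⟨a, b, hba, hab⟩
    refine ⟨⟨(CategoryTheory.Quotient.functor _).map (Rep.ofHom a),
      (CategoryTheory.Quotient.functor _).map (Rep.ofHom b), ?_, ?_⟩⟩
    · rw [← Functor.map_comp, ← CategoryTheory.Functor.map_id,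
        CategoryTheory.Quotient.functor_map_eq_iff]
      exact hba
    · rw [← Functor.map_comp, ← CategoryTheory.Functor.map_id,
        CategoryTheory.Quotient.functor_map_eq_iff]
      exact hab
  · rintro ⟨e⟩
    obtain ⟨a, ha⟩ := (CategoryTheory.Quotient.functor _).map_surjective e.hom
    obtain ⟨b, hb⟩ := (CategoryTheory.Quotient.functor _).map_surjective e.inv
    refine ⟨a.hom, b.hom, ?_, ?_⟩
    · have := e.hom_inv_id
      rw [← ha, ← hb, ← Functor.map_comp, ← CategoryTheory.Functor.map_id,
        CategoryTheory.Quotient.functor_map_eq_iff] at this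
      exact this
    · have := e.inv_hom_id
      rw [← ha, ← hb, ← Functor.map_comp, ← CategoryTheory.Functor.map_id,
        CategoryTheory.Quotient.functor_map_eq_iff] at this
      exact this

/-- If `ρ ≅ α ⊕ τ` and `ρ' ≅ β ⊕ τ'`, where `ρ` and `ρ'` are stably isomorphic and so are `τ` and
`τ'`, then `α` and `β` are stably isomorphic, provided that every nonzero endomorphism of `τ'` is
bijective. -/
theorem StableIso.cancel (h : Splits (Rep.of ρ) (Rep.of σ) (Rep.of τ))
    (h' : Splits (Rep.of ρ') (Rep.of σ') (Rep.of τ')) (hρ : StableIso ρ ρ') (hτ : StableIso τ τ')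
    (hS : ∀ f : τ'.IntertwiningMap τ', f = 0 ∨ Function.Bijective f) : StableIso σ σ' := by
  rw [stableIso_iff] at hρ hτ ⊢
  obtain ⟨e⟩ := hρ
  obtain ⟨e'⟩ := hτ
  refine ((h.map (CategoryTheory.Quotient.functor _)).of_iso e e').cancel
    (h'.map (CategoryTheory.Quotient.functor _)) fun f => ?_
  -- The quotient functor is full, so the dichotomy for endomorphisms of `τ'` passes to the stable
  -- category.
  obtain ⟨f, rfl⟩ := (CategoryTheory.Quotient.functor _).map_surjective f
  obtain hf | hf := hS f.hom
  · left
    have : f = 0 := Rep.hom_ext hf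
    rw [this, Functor.map_zero]
  · right
    have : IsIso f := (Rep.mkIso (f.hom.ofBijective hf)).isIso_hom
    infer_instance

theorem StableIso.lTensor (τ : Representation k G U) (h : StableIso ρ σ) :
    StableIso (τ.tprod ρ) (τ.tprod σ) := by
  obtain ⟨a, b, hba, hab⟩ := h
  refine ⟨IntertwiningMap.lTensor τ a, IntertwiningMap.lTensor τ b,
    (hba.lTensor τ).congr fun v => ?_, (hab.lTensor τ).congr fun v => ?_⟩
  · induction v using TensorProduct.induction_on with
    | zero => simp
    | add x y hx hy => rw [map_add, map_add, hx, hy]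
    | tmul x y => simp [IntertwiningMap.coe_sub, TensorProduct.tmul_sub]
  · induction v using TensorProduct.induction_on with
    | zero => simp
    | add x y hx hy => rw [map_add, map_add, hx, hy]
    | tmul x y => simp [IntertwiningMap.coe_sub, TensorProduct.tmul_sub]

theorem StableIso.rTensor (τ : Representation k G U) (h : StableIso ρ σ) :
    StableIso (ρ.tprod τ) (σ.tprod τ) :=
  ((StableIso.of_equiv (Representation.TensorProduct.comm ρ τ)).trans (h.lTensor τ)).trans
    (StableIso.of_equiv (Representation.TensorProduct.comm τ σ))

omit [Fintype G] in
theorem splits_lTensor (τ : Representation k G U) (h : Splits (Rep.of ρ) (Rep.of σ) (Rep.of σ')) :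
    Splits (Rep.of (τ.tprod ρ)) (Rep.of (τ.tprod σ)) (Rep.of (τ.tprod σ')) := by
  obtain ⟨i, p, j, q, h1, h2, h3, h4, h5⟩ := h
  have key : ∀ {V W U : Type w} [AddCommGroup V] [AddCommGroup W] [AddCommGroup U]
    [Module k V] [Module k W] [Module k U] {ρ : Representation k G V} {σ : Representation k G W}
    {π : Representation k G U} (a : Rep.of ρ ⟶ Rep.of σ) (b : Rep.of σ ⟶ Rep.of π),
    Rep.ofHom (IntertwiningMap.lTensor τ a.hom) ≫ Rep.ofHom (IntertwiningMap.lTensor τ b.hom) =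
      Rep.ofHom (IntertwiningMap.lTensor τ (a ≫ b).hom) := by
    intros
    refine Rep.hom_ext (IntertwiningMap.ext (TensorProduct.ext' fun x y => ?_))
    simp [IntertwiningMap.toLinearMap_apply]
  refine ⟨Rep.ofHom (IntertwiningMap.lTensor τ i.hom), Rep.ofHom (IntertwiningMap.lTensor τ p.hom),
    Rep.ofHom (IntertwiningMap.lTensor τ j.hom), Rep.ofHom (IntertwiningMap.lTensor τ q.hom),
    ?_, ?_, ?_, ?_, ?_⟩
  · rw [key, h1]; simp
  · rw [key, h2]; simp
  · rw [key, h3]; simp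
  · rw [key, h4]; simp
  · rw [key, key, ← Rep.ofHom_add, ← IntertwiningMap.lTensor_add, ← Rep.add_hom, h5]; simp

end Cancellation

open MvPolynomial

/-! ### Symmetric powers of the natural representation -/

section Sym

universe u

/-- Homogeneous polynomials of degree `d` in two variables. -/
abbrev Hom2 (k : Type u) [Field k] (d : ℕ) : Submodule k (MvPolynomial (Fin 2) k) :=
  homogeneousSubmodule (Fin 2) k d

section Basis

variable {k : Type u} [Field k]

/-- The exponent vector `(a, b)`. -/
def expo (a b : ℕ) : Fin 2 →₀ ℕ := Finsupp.single 0 a + Finsupp.single 1 b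

@[simp]
theorem expo_zero (a b : ℕ) : expo a b 0 = a := by simp [expo]

@[simp]
theorem expo_one (a b : ℕ) : expo a b 1 = b := by simp [expo]

theorem expo_inj {a b a' b' : ℕ} : expo a b = expo a' b' ↔ a = a' ∧ b = b' := by
  refine ⟨fun h => ⟨?_, ?_⟩, fun h => by rw [h.1, h.2]⟩
  · rw [← expo_zero a b, h, expo_zero]
  · rw [← expo_one a b, h, expo_one]

theorem eq_expo (m : Fin 2 →₀ ℕ) : m = expo (m 0) (m 1) := by
  ext i
  fin_cases i <;> simp

theorem monomial_expo (a b : ℕ) (c : k) :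
    monomial (expo a b) c = C c * ((X 0 : MvPolynomial (Fin 2) k) ^ a * X 1 ^ b) := by
  rw [monomial_eq, Finsupp.prod_fintype _ _ (by simp)]
  simp

theorem coeff_expo_X_pow_mul (a b a' b' : ℕ) :
    coeff (expo a b) ((X 0 : MvPolynomial (Fin 2) k) ^ a' * X 1 ^ b') =
      if a' = a ∧ b' = b then 1 else 0 := by
  have := monomial_expo (k := k) a' b' 1
  rw [C_1, one_mul] at this
  rw [← this, coeff_monomial]
  simp only [expo_inj]

theorem coeff_expo_eq_zero {d : ℕ} {f : MvPolynomial (Fin 2) k} (hf : f ∈ Hom2 k d) {a b : ℕ}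
    (h : a + b ≠ d) : coeff (expo a b) f = 0 := by
  refine ((mem_homogeneousSubmodule d f).1 hf).coeff_eq_zero ?_
  rwa [Finsupp.degree_eq_sum, Fin.sum_univ_two, expo_zero, expo_one]

theorem X_pow_mul_mem {a b d : ℕ} (h : a + b = d) :
    (X 0 : MvPolynomial (Fin 2) k) ^ a * X 1 ^ b ∈ Hom2 k d := by
  rw [mem_homogeneousSubmodule, ← h]
  exact (isHomogeneous_X_pow 0 a).mul (isHomogeneous_X_pow 1 b)

theorem eq_sum_coeff {d : ℕ} {f : MvPolynomial (Fin 2) k} (hf : f ∈ Hom2 k d) :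
    f = ∑ j ∈ Finset.range (d + 1), C (coeff (expo (d - j) j) f) * (X 0 ^ (d - j) * X 1 ^ j) := by
  ext m
  rw [eq_expo m, coeff_sum]
  simp only [coeff_C_mul, coeff_expo_X_pow_mul]
  by_cases h : m 0 + m 1 = d
  · rw [Finset.sum_eq_single (m 1)]
    · have : d - m 1 = m 0 := by omega
      simp [this]
    · intro j _ hj
      simp [hj]
    · intro hm
      simp at hm
      omega
  · rw [coeff_expo_eq_zero hf h]
    refine (Finset.sum_eq_zero fun j hj => ?_).symm
    rw [if_neg, mul_zero]
    rintro ⟨h1, h2⟩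
    simp at hj
    omega

/-- The monomial `X ^ (d - j) * Y ^ j`. -/
def mono (k : Type u) [Field k] (d : ℕ) (j : Fin (d + 1)) : Hom2 k d :=
  ⟨X 0 ^ (d - j : ℕ) * X 1 ^ (j : ℕ), X_pow_mul_mem (by omega)⟩

/-- Monomials are a basis of the space of homogeneous polynomials. -/
def monoBasis (k : Type u) [Field k] (d : ℕ) : Module.Basis (Fin (d + 1)) k (Hom2 k d) :=
  Module.Basis.ofEquivFun
    { toFun := fun f j => coeff (expo (d - j) j) (f : MvPolynomial (Fin 2) k)
      map_add' := fun f g => by ext j; simp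
      map_smul' := fun c f => by ext j; simp
      invFun := fun c => ∑ j, c j • mono k d j
      left_inv := fun f => by
        refine Subtype.ext ?_
        conv_rhs => rw [eq_sum_coeff f.2]
        rw [Finset.sum_range]
        simp [mono, smul_eq_C_mul]
      right_inv := fun c => by
        ext j
        simp only [Submodule.coe_sum, Submodule.coe_smul, coeff_sum, coeff_smul, mono,
          coeff_expo_X_pow_mul]
        rw [Finset.sum_eq_single j]
        · simp
        · intro i _ hij
          have : ¬ ((i : ℕ) = j) := fun h => hij (Fin.ext h)
          simp [this]
        · simp }

theorem monoBasis_apply (d : ℕ) (j : Fin (d + 1)) : monoBasis k d j = mono k d j := by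
  rw [monoBasis, Module.Basis.coe_ofEquivFun]
  change ∑ i, (Pi.single j 1 : Fin (d + 1) → k) i • mono k d i = _
  simp [Pi.single_apply, ite_smul]

theorem finrank_hom2 (d : ℕ) : Module.finrank k (Hom2 k d) = d + 1 := by
  rw [Module.finrank_eq_card_basis (monoBasis k d), Fintype.card_fin]

end Basis

section Action

variable (p : ℕ) (k : Type u) [Field k] [CharP k p]

/-- The action of `SL₂(𝔽_p)` on homogeneous polynomials of degree `d`. -/
def symRep (d : ℕ) : Representation k (SL2 p) (Hom2 k d) := V p k (d + 1)

variable {p k}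

theorem coe_symRep_apply {d : ℕ} (g : SL2 p) (f : Hom2 k d) :
    ((symRep p k d g f : Hom2 k d) : MvPolynomial (Fin 2) k) = subst p k g.1 f := rfl

theorem subst_X_zero (M : Matrix (Fin 2) (Fin 2) (ZMod p)) :
    subst p k M (X 0) = C (ZMod.castHom (dvd_refl p) k (M 0 0)) * X 0 +
      C (ZMod.castHom (dvd_refl p) k (M 1 0)) * X 1 := by
  simp [subst, Fin.sum_univ_two]

theorem subst_X_one (M : Matrix (Fin 2) (Fin 2) (ZMod p)) :
    subst p k M (X 1) = C (ZMod.castHom (dvd_refl p) k (M 0 1)) * X 0 +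
      C (ZMod.castHom (dvd_refl p) k (M 1 1)) * X 1 := by
  simp [subst, Fin.sum_univ_two]

/-- The unipotent matrix with `Y ↦ t X + Y`. -/
def upper (t : ZMod p) : SL2 p := ⟨!![1, t; 0, 1], by simp [Matrix.det_fin_two]⟩

/-- The unipotent matrix with `X ↦ X + t Y`. -/
def lower (t : ZMod p) : SL2 p := ⟨!![1, 0; t, 1], by simp [Matrix.det_fin_two]⟩

variable [Fact p.Prime]

/-- A Vandermonde argument: the `n ≤ p` points `0, …, n - 1` of the prime field are distinct, so a
polynomial in `t` with fewer than `p + 1` coefficients is determined by its values there. Linear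
forms on `M ⧸ N` reduce it to scalars. -/
theorem mem_of_forall_sum_pow_smul_mem {M : Type*} [AddCommGroup M] [Module k M]
    (N : Submodule k M) {n : ℕ} (hn : n ≤ p) (h : ℕ → M)
    (hN : ∀ t : ZMod p, ∑ m ∈ Finset.range n, (ZMod.castHom (dvd_refl p) k t) ^ m • h m ∈ N)
    {m : ℕ} (hm : m < n) : h m ∈ N := by
  rw [← Submodule.Quotient.mk_eq_zero, ← Module.forall_dual_apply_eq_zero_iff k]
  intro φ
  have hinj : Function.Injective fun i : Fin n => ZMod.castHom (dvd_refl p) k (i : ℕ) := by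
    intro i j hij
    have := (ZMod.castHom (dvd_refl p) k).injective hij
    rw [ZMod.natCast_eq_natCast_iff'] at this
    rw [Nat.mod_eq_of_lt (by omega), Nat.mod_eq_of_lt (by omega)] at this
    exact Fin.ext this
  have := Matrix.eq_zero_of_forall_index_sum_pow_mul_eq_zero
    (v := fun i : Fin n => φ (Submodule.Quotient.mk (h i))) hinj fun j => by
      have h1 := hN (j : ℕ)
      rw [← Submodule.Quotient.mk_eq_zero, Finset.sum_range] at h1
      have h2 := congrArg φ h1
      rw [map_zero, ← Submodule.mkQ_apply, map_sum, map_sum] at h2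
      simpa using h2
  exact congrFun this ⟨m, hm⟩

/-- The coefficients of `f(X, Y + t X)` as a polynomial in `t`. -/
def shiftCoeff {d : ℕ} (f : Hom2 k d) (m : ℕ) : Hom2 k d :=
  ∑ j ∈ Finset.range (d + 1), if h : m ≤ j ∧ j ≤ d then
    (coeff (expo (d - j) j) (f : MvPolynomial (Fin 2) k) * (j.choose m : k)) •
      ⟨X 0 ^ (d - (j - m)) * X 1 ^ (j - m), X_pow_mul_mem (by omega)⟩ else 0

theorem upper_apply {d : ℕ} (f : Hom2 k d) (t : ZMod p) :
    symRep p k d (upper t) f =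
      ∑ m ∈ Finset.range (d + 1), (ZMod.castHom (dvd_refl p) k t) ^ m • shiftCoeff f m := by
  refine Subtype.ext ?_
  rw [coe_symRep_apply]
  conv_lhs => rw [eq_sum_coeff f.2]
  set τ := ZMod.castHom (dvd_refl p) k t with hτ
  simp only [shiftCoeff, Finset.smul_sum, Submodule.coe_sum, map_sum]
  rw [Finset.sum_comm]
  refine Finset.sum_congr rfl fun j hj => ?_
  rw [Finset.mem_range] at hj
  rw [map_mul, map_mul, map_pow, map_pow, subst_X_zero, subst_X_one]
  have : subst p k (upper t).1 (C (coeff (expo (d - j) j) (f : MvPolynomial (Fin 2) k))) =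
    C (coeff (expo (d - j) j) (f : MvPolynomial (Fin 2) k)) := by simp [subst]
  rw [this]
  simp only [upper, Matrix.of_apply, Matrix.cons_val', Matrix.cons_val_zero, Matrix.cons_val_one,
    map_one, map_zero, zero_mul, add_zero, one_mul, ← hτ, Matrix.cons_val_fin_one]
  rw [add_pow, Finset.mul_sum, Finset.mul_sum]
  have hsub : Finset.range (j + 1) ⊆ Finset.range (d + 1) := by
    intro x; simp; omega
  refine (Finset.sum_congr rfl fun m hm => ?_).trans (Finset.sum_subset hsub fun m _ hm => ?_)
  · rw [Finset.mem_range] at hm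
    rw [dif_pos (by omega)]
    have e : d - (j - m) = (d - j) + m := by omega
    simp only [Submodule.coe_smul, smul_eq_C_mul, e, pow_add, mul_pow, map_mul, map_pow,
      map_natCast]
    ring
  · rw [dif_neg]
    · simp
    · simp at hm; omega

theorem shiftCoeff_zero {d : ℕ} (f : Hom2 k d) : shiftCoeff f 0 = f := by
  refine Subtype.ext ?_
  conv_rhs => rw [eq_sum_coeff f.2]
  rw [shiftCoeff, Submodule.coe_sum]
  refine Finset.sum_congr rfl fun j hj => ?_
  rw [Finset.mem_range] at hj
  rw [dif_pos (by omega)]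
  simp [smul_eq_C_mul]

/-- With no power of `Y` above `Y ^ m` in `f`, only the `Y ^ m` term reaches `t ^ m`, through the
summand `(t X) ^ m` of `(Y + t X) ^ m`. -/
theorem shiftCoeff_top {d : ℕ} (f : Hom2 k d) {m : ℕ} (hm : m ≤ d)
    (hf : ∀ j, m < j → j ≤ d → coeff (expo (d - j) j) (f : MvPolynomial (Fin 2) k) = 0) :
    shiftCoeff f m = coeff (expo (d - m) m) (f : MvPolynomial (Fin 2) k) • mono k d 0 := by
  rw [shiftCoeff, Finset.sum_eq_single m]
  · rw [dif_pos (by omega)]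
    refine Subtype.ext ?_
    simp [mono]
  · intro j hj hjm
    split_ifs with h
    · rw [hf j (by omega) h.2, zero_mul, zero_smul]
    · rfl
  · simp; omega

theorem exists_top {d : ℕ} {f : Hom2 k d} (hf : f ≠ 0) : ∃ m ≤ d,
    coeff (expo (d - m) m) (f : MvPolynomial (Fin 2) k) ≠ 0 ∧
    ∀ j, m < j → j ≤ d → coeff (expo (d - j) j) (f : MvPolynomial (Fin 2) k) = 0 := by
  classical
  have hne : ∃ m ≤ d, coeff (expo (d - m) m) (f : MvPolynomial (Fin 2) k) ≠ 0 := by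
    by_contra! h
    apply hf
    refine Subtype.ext ?_
    rw [eq_sum_coeff f.2]
    refine Finset.sum_eq_zero fun j hj => ?_
    rw [Finset.mem_range] at hj
    rw [h j (by omega)]
    simp
  let P : ℕ → Prop := fun m => m ≤ d ∧ coeff (expo (d - m) m) (f : MvPolynomial (Fin 2) k) ≠ 0
  obtain ⟨m₀, h0⟩ := hne
  have hP : P m₀ := h0
  have h1 : P (Nat.findGreatest P d) := Nat.findGreatest_spec hP.1 hP
  refine ⟨Nat.findGreatest P d, h1.1, h1.2, fun j hj hjd => ?_⟩
  by_contra h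
  exact Nat.findGreatest_is_greatest hj hjd ⟨hjd, h⟩

/-- A vector fixed by the upper unipotent matrices is a multiple of `X ^ d`. -/
theorem eq_smul_of_forall_upper {d : ℕ} (hd : d < p) {f : Hom2 k d}
    (hf : ∀ t, symRep p k d (upper t) f = f) :
    f = coeff (expo d 0) (f : MvPolynomial (Fin 2) k) • mono k d 0 := by
  by_cases h0 : f = 0
  · rw [h0]; simp
  obtain ⟨m, hm, hne, htop⟩ := exists_top h0
  obtain rfl | hpos := Nat.eq_zero_or_pos m
  · have := shiftCoeff_top f hm htop
    rwa [shiftCoeff_zero] at this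
  · exfalso
    -- The coefficient of `t ^ 0` is `f` itself, so invariance says that the sum with this term
    -- replaced by zero vanishes for all `t`.
    have := mem_of_forall_sum_pow_smul_mem (⊥ : Submodule k (Hom2 k d)) (n := d + 1) hd
      (fun i => if i = 0 then 0 else shiftCoeff f i) (fun t => by
        have h := hf t
        rw [upper_apply, Finset.sum_range_succ', shiftCoeff_zero, pow_zero, one_smul,
          add_eq_right] at h
        rw [Submodule.mem_bot, Finset.sum_range_succ']
        simpa using h) (m := m) (by omega)
    rw [if_neg hpos.ne', shiftCoeff_top f hm htop, Submodule.mem_bot] at this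
    have h1 := (smul_eq_zero.1 this).resolve_left hne
    rw [← monoBasis_apply] at h1
    exact (monoBasis k d).ne_zero 0 h1

theorem lower_mono_zero (d : ℕ) (t : ZMod p) :
    symRep p k d (lower t) (mono k d 0) = ∑ m ∈ Finset.range (d + 1),
      (ZMod.castHom (dvd_refl p) k t) ^ m •
        (if h : m < d + 1 then (d.choose m : k) • mono k d ⟨m, h⟩ else 0) := by
  refine Subtype.ext ?_
  rw [coe_symRep_apply]
  simp only [mono, Fin.val_zero, tsub_zero, pow_zero, mul_one, map_pow, subst_X_zero]
  simp only [lower, Matrix.of_apply, Matrix.cons_val', Matrix.cons_val_zero, Matrix.cons_val_one,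
    map_one, one_mul, Matrix.cons_val_fin_one, Submodule.coe_sum]
  rw [add_comm, add_pow]
  refine Finset.sum_congr rfl fun m hm => ?_
  rw [dif_pos (Finset.mem_range.1 hm)]
  simp only [Submodule.coe_smul, smul_eq_C_mul, mul_pow, map_pow, map_natCast]
  ring

/-- `X ^ d` generates the space of polynomials of degree `d`, for `d < p`. -/
theorem eq_top_of_mono_zero_mem {d : ℕ} (hd : d < p) {N : Submodule k (Hom2 k d)}
    (hN : ∀ t, ∀ v ∈ N, symRep p k d (lower t) v ∈ N) (h0 : mono k d 0 ∈ N) : N = ⊤ := by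
  rw [eq_top_iff, ← (monoBasis k d).span_eq, Submodule.span_le]
  rintro _ ⟨j, rfl⟩
  rw [monoBasis_apply]
  have := mem_of_forall_sum_pow_smul_mem N (n := d + 1) hd
    (fun m => if h : m < d + 1 then (d.choose m : k) • mono k d ⟨m, h⟩ else 0)
    (fun t => by rw [← lower_mono_zero]; exact hN t _ h0) j.2
  rw [dif_pos j.2] at this
  refine (N.smul_mem_iff ?_).1 this
  rw [Ne, CharP.cast_eq_zero_iff k p]
  intro hdvd
  have h1 : p ∣ d.factorial := by
    rw [← Nat.choose_mul_factorial_mul_factorial (show (j : ℕ) ≤ d by omega), mul_assoc]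
    exact hdvd.mul_right _
  exact absurd ((Nat.Prime.dvd_factorial Fact.out).1 h1) (by omega)

/-- The simplicity of `V_{d+1}`, for `d < p`. -/
theorem eq_bot_or_eq_top {d : ℕ} (hd : d < p) {N : Submodule k (Hom2 k d)}
    (hN : ∀ g, ∀ v ∈ N, symRep p k d g v ∈ N) : N = ⊥ ∨ N = ⊤ := by
  rw [or_iff_not_imp_left]
  intro h
  obtain ⟨f, hfN, hf⟩ := N.ne_bot_iff.1 h
  refine eq_top_of_mono_zero_mem hd (fun t => hN _) ?_
  obtain ⟨m, hm, hne, htop⟩ := exists_top hf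
  -- The unipotent orbit of any nonzero `f` in `N` yields a nonzero multiple of `X ^ d`, and that
  -- vector generates.
  have := mem_of_forall_sum_pow_smul_mem N (n := d + 1) hd (shiftCoeff f)
    (fun t => by rw [← upper_apply]; exact hN _ _ hfN) (m := m) (by omega)
  rw [shiftCoeff_top f hm htop] at this
  exact (N.smul_mem_iff hne).1 this

end Action

end Sym

/-! ### Endomorphisms of the simple modules and projectivity of the Steinberg module -/

section Simple

universe u

variable {p : ℕ} {k : Type u} [Field k] [CharP k p] [Fact p.Prime]

/-- Schur's lemma, applied to the kernel. -/
theorem symRep_eq_zero_or_bijective {d : ℕ} (hd : d < p)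
    (f : (symRep p k d).IntertwiningMap (symRep p k d)) : f = 0 ∨ Function.Bijective f := by
  obtain h | h := eq_bot_or_eq_top hd (N := LinearMap.ker f.toLinearMap) fun g v hv => by
    have hv : f v = 0 := hv
    change f _ = 0
    rw [f.isIntertwining, hv, map_zero]
  · right
    have hinj : Function.Injective f := LinearMap.ker_eq_bot.1 h
    exact ⟨hinj, LinearMap.injective_iff_surjective.1 hinj⟩
  · left
    exact IntertwiningMap.ext (LinearMap.ker_eq_top.1 h)

theorem upper_mul (s t : ZMod p) : upper s * upper t = upper (s + t) := by
  refine Subtype.ext ?_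
  change (!![1, s; 0, 1] * !![1, t; 0, 1] : Matrix (Fin 2) (Fin 2) (ZMod p)) = !![1, s + t; 0, 1]
  rw [Matrix.mul_fin_two]
  simp [add_comm]

theorem upper_zero : upper (0 : ZMod p) = 1 := by
  refine Subtype.ext ?_
  change (!![1, 0; 0, 1] : Matrix (Fin 2) (Fin 2) (ZMod p)) = 1
  rw [Matrix.one_fin_two]

theorem upper_pow (n : ℕ) : upper (1 : ZMod p) ^ n = upper (n : ZMod p) := by
  induction n with
  | zero => rw [pow_zero, Nat.cast_zero, upper_zero]
  | succ n ih => rw [pow_succ, ih, upper_mul, Nat.cast_succ]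

omit [Fact p.Prime] in
theorem upper_injective : Function.Injective (upper (p := p)) := fun s t h => by
  have := congrArg (fun g : SL2 p => g.1 0 1) h
  simpa [upper] using this

theorem dvd_card_SL2 : p ∣ Fintype.card (SL2 p) := by
  have h : orderOf (upper (1 : ZMod p)) = p := by
    refine orderOf_eq_prime ?_ ?_
    · rw [upper_pow, CharP.cast_eq_zero, upper_zero]
    · rw [← upper_zero]
      intro h
      simpa using upper_injective h
  exact h.symm.dvd.trans orderOf_dvd_card

/-- Every relative trace on `V_{d+1}` vanishes if `d + 1 < p`. -/
theorem symRep_isTrace_eq_zero {d : ℕ} (hd : d + 1 < p)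
    {f : (symRep p k d).IntertwiningMap (symRep p k d)} (hf : IsTrace f) : f = 0 := by
  refine (symRep_eq_zero_or_bijective (by omega) f).resolve_right fun hb => ?_
  -- If the identity were the relative trace of `φ`, comparing linear traces would give `d + 1 = |G|
  -- tr φ = 0` in `k`, as `p` divides `|G|`; but `0 < d + 1 < p`.
  obtain ⟨φ, hφ⟩ := isProjective_iff_isTrace_id.1 (isProjective_of_bijective hf hb)
  have h1 := congrArg (fun x => LinearMap.trace k _ (IntertwiningMap.toLinearMap x)) hφ
  have h2 : LinearMap.trace k _ (relTrace (symRep p k d) (symRep p k d) φ).toLinearMap = 0 := by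
    change LinearMap.trace k _ (∑ g, symRep p k d g ∘ₗ φ ∘ₗ symRep p k d g⁻¹) = 0
    rw [map_sum]
    have : ∀ g : SL2 p, LinearMap.trace k _ (symRep p k d g ∘ₗ φ ∘ₗ symRep p k d g⁻¹) =
        LinearMap.trace k _ φ := fun g => by
      rw [LinearMap.trace_comp_comm', LinearMap.comp_assoc, ← Module.End.mul_eq_comp (symRep p k d g⁻¹),
        ← map_mul, inv_mul_cancel, map_one]
      rfl
    rw [Finset.sum_congr rfl fun g _ => this g, Finset.sum_const, Finset.card_univ, nsmul_eq_mul,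
      (CharP.cast_eq_zero_iff k p _).2 dvd_card_SL2, zero_mul]
  rw [h2] at h1
  have h3 : LinearMap.trace k _ (IntertwiningMap.id (symRep p k d)).toLinearMap = ((d + 1 : ℕ) : k) := by
    rw [IntertwiningMap.toLinearMap_id, LinearMap.trace_id, finrank_hom2]
  rw [h3] at h1
  have := Nat.le_of_dvd (by omega) ((CharP.cast_eq_zero_iff k p _).1 h1.symm)
  omega

/-- The order of summation puts `c` innermost, where the determinant equation determines it once `b
≠ 0`. -/
theorem sum_det_one_eq (F : ZMod p → ZMod p → ZMod p → ZMod p → ZMod p) :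
    ∑ g : SL2 p, F (g.1 0 0) (g.1 0 1) (g.1 1 0) (g.1 1 1) =
      ∑ a, ∑ d, ∑ b, ∑ c, if a * d - b * c = 1 then F a b c d else 0 := by
  have e : ∑ g : SL2 p, F (g.1 0 0) (g.1 0 1) (g.1 1 0) (g.1 1 1) =
      ∑ x : ((ZMod p × ZMod p) × (ZMod p × ZMod p)) with x.1.1 * x.1.2 - x.2.1 * x.2.2 = 1,
        F x.1.1 x.2.1 x.2.2 x.1.2 := by
    refine Finset.sum_bij' (fun g _ => ((g.1 0 0, g.1 1 1), (g.1 0 1, g.1 1 0)))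
      (fun x hx => ⟨!![x.1.1, x.2.1; x.2.2, x.1.2], by
        rw [Matrix.det_fin_two_of]; exact (Finset.mem_filter.1 hx).2⟩) ?_ ?_ ?_ ?_ ?_
    · intro g _
      have := g.2
      rw [Matrix.det_fin_two] at this
      simpa using this
    · exact fun _ _ => Finset.mem_univ _
    · intro g _
      refine Subtype.ext ?_
      exact (Matrix.eta_fin_two g.1).symm
    · intro x _
      rfl
    · intro g _
      rfl
  rw [e, Finset.sum_filter, Fintype.sum_prod_type, Fintype.sum_prod_type]
  refine Finset.sum_congr rfl fun a _ => Finset.sum_congr rfl fun d _ => ?_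
  rw [Fintype.sum_prod_type]

/-- A `(p - 1)`-st power in the prime field is the indicator of nonzero elements, so this counts
modulo `p` the matrices with `b c ≠ 0`. There are `p² - (p - 1)` pairs with `a d ≠ 1`, each
admitting `p - 1` values of `b`, and then `c` is determined: `(p² - p + 1)(p - 1) ≡ -1`. -/
theorem sum_SL2_pow :
    ∑ g : SL2 p, (-(g.1 1 0)) ^ (p - 1) * (g.1 0 1) ^ (p - 1) = -1 := by
  have hp1 : p.Prime := Fact.out
  rw [sum_det_one_eq fun a b c d => (-c) ^ (p - 1) * b ^ (p - 1)]
  have h1 : ∀ a d b : ZMod p, (∑ c, if a * d - b * c = 1 then (-c) ^ (p - 1) * b ^ (p - 1) else 0)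
      = if a * d = 1 then 0 else if b = 0 then 0 else 1 := by
    intro a d b
    by_cases hb : b = 0
    · subst hb
      simp [hp1.one_lt, Nat.sub_eq_zero_iff_le]
    rw [Finset.sum_eq_single ((a * d - 1) * b⁻¹)]
    · have : a * d - b * ((a * d - 1) * b⁻¹) = 1 := by field_simp; ring
      rw [if_pos this, if_neg hb, ZMod.pow_card_sub_one_eq_one hb, mul_one]
      split_ifs with had
      · rw [had]
        simp [Nat.sub_eq_zero_iff_le, hp1.one_lt]
      · exact ZMod.pow_card_sub_one_eq_one
          (neg_ne_zero.2 (mul_ne_zero (sub_ne_zero.2 had) (inv_ne_zero hb)))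
    · intro c _ hc
      rw [if_neg]
      intro h
      apply hc
      rw [eq_mul_inv_iff_mul_eq₀ hb, ← h]
      ring
    · simp
  simp only [h1]
  have h2 : ∀ a d : ZMod p, (∑ b : ZMod p, if a * d = 1 then (0 : ZMod p) else if b = 0 then 0 else 1)
      = if a * d = 1 then 0 else -1 := by
    intro a d
    split_ifs
    · simp
    · rw [Finset.sum_ite, Finset.sum_const_zero, zero_add, Finset.sum_const, Finset.filter_ne',
        Finset.card_erase_of_mem (Finset.mem_univ _), Finset.card_univ, ZMod.card, nsmul_eq_mul,
        mul_one, Nat.cast_sub hp1.one_lt.le, CharP.cast_eq_zero]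
      simp
  simp only [h2]
  have h3 : ∀ a : ZMod p, (∑ d : ZMod p, if a * d = 1 then (0 : ZMod p) else -1) =
      if a = 0 then 0 else 1 := by
    intro a
    -- The `p` constant terms `-1` sum to zero, so only the correction at `d = a⁻¹` survives.
    have : ∀ d : ZMod p, (if a * d = 1 then (0 : ZMod p) else -1) =
        (-1) + if a * d = 1 then 1 else 0 := fun d => by split_ifs <;> simp
    simp only [this, Finset.sum_add_distrib, Finset.sum_const, Finset.card_univ, ZMod.card,
      nsmul_eq_mul, CharP.cast_eq_zero, zero_mul, zero_add]
    split_ifs with ha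
    · simp [ha]
    · rw [Finset.sum_eq_single a⁻¹]
      · simp [ha]
      · intro d _ hd
        rw [if_neg fun h => hd (eq_inv_of_mul_eq_one_right h)]
      · simp
  simp only [h3]
  rw [Finset.sum_ite, Finset.sum_const_zero, zero_add, Finset.sum_const, Finset.filter_ne',
    Finset.card_erase_of_mem (Finset.mem_univ _), Finset.card_univ, ZMod.card, nsmul_eq_mul,
    mul_one, Nat.cast_sub hp1.one_lt.le, CharP.cast_eq_zero]
  simp

omit [CharP k p] [Fact p.Prime] in
theorem linear_pow (d : ℕ) (a b : k) :
    (C a * X 0 + C b * X 1 : MvPolynomial (Fin 2) k) ^ d = ∑ m ∈ Finset.range (d + 1),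
      C (a ^ (d - m) * b ^ m * (d.choose m : k)) * (X 0 ^ (d - m) * X 1 ^ m) := by
  rw [add_comm, add_pow]
  refine Finset.sum_congr rfl fun m _ => ?_
  simp only [mul_pow, map_mul, map_pow, map_natCast]
  ring

omit [CharP k p] [Fact p.Prime] in
theorem coeff_linear_pow {d j : ℕ} (hj : j ≤ d) (a b : k) :
    coeff (expo (d - j) j) ((C a * X 0 + C b * X 1 : MvPolynomial (Fin 2) k) ^ d) =
      a ^ (d - j) * b ^ j * (d.choose j : k) := by
  rw [linear_pow, coeff_sum, Finset.sum_eq_single j]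
  · rw [coeff_C_mul, coeff_expo_X_pow_mul, if_pos ⟨rfl, rfl⟩, mul_one]
  · intro m _ hm
    rw [coeff_C_mul, coeff_expo_X_pow_mul, if_neg (by tauto), mul_zero]
  · intro h
    exact absurd (Finset.mem_range.2 (by omega)) h

/-- The Steinberg module is projective. -/
theorem symRep_isProjective : IsProjective (symRep p k (p - 1)) := by
  have hp1 : p.Prime := Fact.out
  have hd : p - 1 < p := by have := hp1.pos; omega
  set d := p - 1 with hd'
  -- The witness is the relative trace `F` of the rank one map `f ↦ ℓ(f) Y ^ d`, with `ℓ` the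
  -- coefficient of `Y ^ d`. Once `F` is nonzero, Schur's lemma makes it bijective and the module
  -- projective.
  let ℓ : Hom2 k d →ₗ[k] k :=
    { toFun := fun f => coeff (expo 0 d) (f : MvPolynomial (Fin 2) k)
      map_add' := fun _ _ => by simp
      map_smul' := fun _ _ => by simp }
  let y : Hom2 k d := ⟨X 0 ^ 0 * X 1 ^ d, X_pow_mul_mem (by omega)⟩
  let F := relTrace (symRep p k d) (symRep p k d) (LinearMap.toSpanSingleton k _ y ∘ₗ ℓ)
  have hFt : IsTrace F := ⟨_, rfl⟩
  have hx : mono k d 0 ≠ 0 := by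
    rw [← monoBasis_apply]; exact (monoBasis k d).ne_zero 0
  have hfix : ∀ t, symRep p k d (upper t) (F (mono k d 0)) = F (mono k d 0) := fun t => by
    rw [← F.isIntertwining]
    congr 1
    refine Subtype.ext ?_
    rw [coe_symRep_apply]
    simp [mono, subst_X_zero, upper]
  have hF := eq_smul_of_forall_upper hd hfix
  -- The term of `g = (a b; c d)` is the coefficient `(-c) ^ (p - 1)` of `Y ^ (p - 1)` in `g⁻¹ X ^
  -- (p - 1)` times the coefficient `b ^ (p - 1)` of `X ^ (p - 1)` in `g Y ^ (p - 1)`.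
  have hc : coeff (expo d 0) ((F (mono k d 0) : Hom2 k d) : MvPolynomial (Fin 2) k) = -1 := by
    rw [relTrace_apply, Submodule.coe_sum, coeff_sum]
    rw [← map_one (ZMod.castHom (dvd_refl p) k), ← map_neg, ← sum_SL2_pow, map_sum]
    refine Finset.sum_congr rfl fun g _ => ?_
    rw [LinearMap.comp_apply, LinearMap.toSpanSingleton_apply, map_smul, Submodule.coe_smul,
      coeff_smul, smul_eq_mul, coe_symRep_apply, (ZMod.castHom (dvd_refl p) k).map_mul]
    congr 1
    · change coeff (expo 0 d) ((symRep p k d g⁻¹ (mono k d 0) : Hom2 k d) : MvPolynomial _ k) = _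
      rw [coe_symRep_apply]
      simp only [mono, Fin.val_zero, tsub_zero, pow_zero, mul_one, map_pow, subst_X_zero]
      have := coeff_linear_pow (k := k) (le_refl d)
      simp only [tsub_self, pow_zero, one_mul, Nat.choose_self, Nat.cast_one, mul_one] at this
      rw [this]
      have h1 : (g⁻¹ : SL2 p).1 1 0 = -(g.1 1 0) := by
        rw [Matrix.SpecialLinearGroup.coe_inv, Matrix.adjugate_fin_two]
        simp
      rw [h1]
    · simp only [y, pow_zero, one_mul, map_pow, subst_X_one]
      have := coeff_linear_pow (k := k) (Nat.zero_le d)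
      simp only [tsub_zero, pow_zero, mul_one, Nat.choose_zero_right, Nat.cast_one] at this
      rw [this]
  rw [hc] at hF
  refine isProjective_of_bijective hFt ((symRep_eq_zero_or_bijective hd F).resolve_left ?_)
  intro h
  have h0 : F (mono k d 0) = 0 := by rw [h]; rfl
  rw [h0] at hF
  exact hx ((smul_eq_zero.1 hF.symm).resolve_left (neg_ne_zero.2 one_ne_zero))

end Simple

/-! ### The tensor product with the natural representation -/

section ClebschGordan

universe u

section Maps

variable {k : Type u} [Field k]

instance Hom2.tensorAddCommGroup (d e : ℕ) : AddCommGroup (Hom2 k d ⊗[k] Hom2 k e) :=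
  TensorProduct.addCommGroup

/-- Multiplication by a variable. -/
def mulX (i : Fin 2) (d : ℕ) : Hom2 k d →ₗ[k] Hom2 k (d + 1) :=
  ((LinearMap.mulRight k (X i : MvPolynomial (Fin 2) k)).domRestrict _).codRestrict _
    fun f => f.2.mul (isHomogeneous_X k i)

@[simp]
theorem coe_mulX (i : Fin 2) {d : ℕ} (f : Hom2 k d) :
    ((mulX i d f : Hom2 k (d + 1)) : MvPolynomial (Fin 2) k) = f.1 * X i := rfl

/-- The partial derivatives. -/
def partialD (i : Fin 2) (d : ℕ) : Hom2 k (d + 1) →ₗ[k] Hom2 k d :=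
  ((pderiv i).toLinearMap.domRestrict (Hom2 k (d + 1))).codRestrict _
    fun f => IsHomogeneous.pderiv f.2

@[simp]
theorem coe_partialD (i : Fin 2) {d : ℕ} (f : Hom2 k (d + 1)) :
    ((partialD i d f : Hom2 k d) : MvPolynomial (Fin 2) k) = pderiv i f.1 := rfl

/-- The variables, as linear forms. -/
def lin (k : Type u) [Field k] (i : Fin 2) : Hom2 k 1 := ⟨X i, isHomogeneous_X k i⟩

@[simp]
theorem coe_lin (i : Fin 2) : ((lin k i : Hom2 k 1) : MvPolynomial (Fin 2) k) = X i := rfl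

/-- The coordinates of a linear form. -/
def linCoord (k : Type u) [Field k] (i : Fin 2) : Hom2 k 1 →ₗ[k] k :=
  (lcoeff k (Finsupp.single i 1)).domRestrict _

@[simp]
theorem linCoord_lin (i j : Fin 2) : linCoord k i (lin k j) = if j = i then 1 else 0 := by
  change coeff _ (X j) = _
  rw [coeff_X]
  simp [Finsupp.single_left_inj]

theorem eq_linCoord (f : Hom2 k 1) : f = linCoord k 0 f • lin k 0 + linCoord k 1 f • lin k 1 := by
  refine Subtype.ext ?_
  conv_lhs => rw [eq_sum_coeff f.2]
  simp [Finset.sum_range_succ, expo, smul_eq_C_mul, linCoord]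

theorem tensor_induction {d : ℕ} {P : Hom2 k d ⊗[k] Hom2 k 1 → Prop}
    (h : ∀ f g, P (f ⊗ₜ lin k 0 + g ⊗ₜ lin k 1)) (t : Hom2 k d ⊗[k] Hom2 k 1) : P t := by
  have : ∃ f g, t = f ⊗ₜ lin k 0 + g ⊗ₜ lin k 1 := by
    induction t using TensorProduct.induction_on with
    | zero => exact ⟨0, 0, by simp⟩
    | tmul f l =>
      refine ⟨linCoord k 0 l • f, linCoord k 1 l • f, ?_⟩
      rw [TensorProduct.smul_tmul, TensorProduct.smul_tmul, ← TensorProduct.tmul_add,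
        ← eq_linCoord]
    | add s t hs ht =>
      obtain ⟨f, g, rfl⟩ := hs
      obtain ⟨f', g', rfl⟩ := ht
      exact ⟨f + f', g + g', by simp only [TensorProduct.add_tmul]; abel⟩
  obtain ⟨f, g, rfl⟩ := this
  exact h f g

/-- Multiplication by linear forms. -/
def muL (k : Type u) [Field k] (d : ℕ) : Hom2 k d ⊗[k] Hom2 k 1 →ₗ[k] Hom2 k (d + 1) :=
  TensorProduct.lift
    (((LinearMap.toSpanSingleton k _ (mulX 0 d)).comp (linCoord k 0) +
      (LinearMap.toSpanSingleton k _ (mulX 1 d)).comp (linCoord k 1)).flip)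

@[simp]
theorem muL_lin {d : ℕ} (f : Hom2 k d) (i : Fin 2) : muL k d (f ⊗ₜ lin k i) = mulX i d f := by
  fin_cases i <;> simp [muL]

/-- Polarization, `f ↦ f_X ⊗ X + f_Y ⊗ Y`. -/
def deltaL (k : Type u) [Field k] (d : ℕ) : Hom2 k (d + 1) →ₗ[k] Hom2 k d ⊗[k] Hom2 k 1 :=
  ((TensorProduct.mk k _ _).flip (lin k 0)).comp (partialD 0 d) +
    ((TensorProduct.mk k _ _).flip (lin k 1)).comp (partialD 1 d)

theorem deltaL_apply {d : ℕ} (f : Hom2 k (d + 1)) :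
    deltaL k d f = partialD 0 d f ⊗ₜ lin k 0 + partialD 1 d f ⊗ₜ lin k 1 := rfl

/-- The Koszul map, `f ↦ f X ⊗ Y - f Y ⊗ X`. -/
def kappaL (k : Type u) [Field k] (d : ℕ) : Hom2 k d →ₗ[k] Hom2 k (d + 1) ⊗[k] Hom2 k 1 :=
  ((TensorProduct.mk k _ _).flip (lin k 1)).comp (mulX 0 d) +
    (-1 : k) • ((TensorProduct.mk k _ _).flip (lin k 0)).comp (mulX 1 d)

theorem kappaL_apply {d : ℕ} (f : Hom2 k d) :
    kappaL k d f = mulX 0 d f ⊗ₜ lin k 1 - mulX 1 d f ⊗ₜ lin k 0 := by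
  rw [sub_eq_add_neg, ← neg_one_smul k]
  rfl

/-- The Poisson bracket with linear forms, `f ⊗ l ↦ f_X l_Y - f_Y l_X`. -/
def lambdaL (k : Type u) [Field k] (d : ℕ) : Hom2 k (d + 1) ⊗[k] Hom2 k 1 →ₗ[k] Hom2 k d :=
  TensorProduct.lift
    (((LinearMap.toSpanSingleton k _ (partialD 0 d)).comp (linCoord k 1) +
      (-1 : k) • (LinearMap.toSpanSingleton k _ (partialD 1 d)).comp (linCoord k 0)).flip)

@[simp]
theorem lambdaL_lin_zero {d : ℕ} (f : Hom2 k (d + 1)) :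
    lambdaL k d (f ⊗ₜ lin k 0) = -partialD 1 d f := by
  simp [lambdaL]

@[simp]
theorem lambdaL_lin_one {d : ℕ} (f : Hom2 k (d + 1)) :
    lambdaL k d (f ⊗ₜ lin k 1) = partialD 0 d f := by
  simp [lambdaL]

theorem euler {d : ℕ} (f : Hom2 k d) :
    X 0 * pderiv 0 f.1 + X 1 * pderiv 1 f.1 = C (d : k) * f.1 := by
  have := IsHomogeneous.sum_X_mul_pderiv ((mem_homogeneousSubmodule _ _).1 f.2)
  rw [Fin.sum_univ_two] at this
  rw [this, nsmul_eq_mul, map_natCast]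

theorem muL_deltaL {d : ℕ} (f : Hom2 k (d + 1)) :
    muL k d (deltaL k d f) = ((d + 1 : ℕ) : k) • f := by
  rw [deltaL_apply, map_add, muL_lin, muL_lin]
  refine Subtype.ext ?_
  have := euler f
  simp only [Submodule.coe_add, coe_mulX, coe_partialD, Submodule.coe_smul, smul_eq_C_mul, ← this]
  ring

theorem muL_kappaL {d : ℕ} (f : Hom2 k d) : muL k (d + 1) (kappaL k d f) = 0 := by
  rw [kappaL_apply, map_sub, muL_lin, muL_lin]
  refine Subtype.ext ?_
  simp only [Submodule.coe_sub, coe_mulX, Submodule.coe_zero]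
  ring

/-- The composite is `∂_X(f X) + ∂_Y(f Y)`: Euler's identity gives `d`, and the product rule adds
`2`. -/
theorem lambdaL_kappaL {d : ℕ} (f : Hom2 k d) :
    lambdaL k d (kappaL k d f) = ((d + 2 : ℕ) : k) • f := by
  rw [kappaL_apply, map_sub, lambdaL_lin_zero, lambdaL_lin_one]
  refine Subtype.ext ?_
  have := euler f
  have h2 : C ((d + 2 : ℕ) : k) * f.1 = C (d : k) * f.1 + f.1 + f.1 := by
    rw [show ((d + 2 : ℕ) : k) = (d : k) + 1 + 1 by push_cast; ring, map_add, map_add, map_one,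
      add_mul, add_mul, one_mul]
  simp only [Submodule.coe_sub, Submodule.coe_neg, coe_mulX, coe_partialD, Submodule.coe_smul,
    smul_eq_C_mul, pderiv_mul, pderiv_X_self, h2, ← this]
  ring

/-- Mixed partial derivatives commute. -/
theorem lambdaL_deltaL {d : ℕ} (f : Hom2 k (d + 2)) : lambdaL k d (deltaL k (d + 1) f) = 0 := by
  rw [deltaL_apply, map_add, lambdaL_lin_zero, lambdaL_lin_one]
  refine Subtype.ext ?_
  simp only [Submodule.coe_add, Submodule.coe_neg, coe_partialD, Submodule.coe_zero]
  rw [neg_add_eq_zero]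
  induction f.1 using MvPolynomial.induction_on' with
  | add f g hf hg => simp only [map_add, hf, hg]
  | monomial m a =>
    rw [pderiv_monomial, pderiv_monomial, pderiv_monomial, pderiv_monomial, tsub_right_comm]
    congr 1
    simp
    ring

/-- When `d + 2` is invertible, dividing by it gives complementary idempotents, hence the
Clebsch-Gordan splitting. The identity itself holds without invertibility and also yields the
equivariance of `lambdaL`. -/
theorem deltaL_muL_add_kappaL_lambdaL {d : ℕ} (t : Hom2 k (d + 1) ⊗[k] Hom2 k 1) :
    deltaL k (d + 1) (muL k (d + 1) t) + kappaL k d (lambdaL k d t) = ((d + 2 : ℕ) : k) • t := by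
  induction t using tensor_induction with
  | h f g =>
  have hf := euler f
  have hg := euler g
  have e1 : partialD 0 (d + 1) (mulX 0 (d + 1) f) + mulX 1 d (partialD 1 d f) =
      ((d + 2 : ℕ) : k) • f := by
    refine Subtype.ext ?_
    simp only [Submodule.coe_add, coe_mulX, coe_partialD, Submodule.coe_smul, smul_eq_C_mul,
      pderiv_mul, pderiv_X_self]
    have : C ((d + 2 : ℕ) : k) * f.1 = C ((d + 1 : ℕ) : k) * f.1 + f.1 := by
      rw [show ((d + 2 : ℕ) : k) = ((d + 1 : ℕ) : k) + 1 by push_cast; ring, map_add, map_one,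
        add_mul, one_mul]
    rw [this, ← hf]
    ring
  have e2 : partialD 1 (d + 1) (mulX 0 (d + 1) f) = mulX 0 d (partialD 1 d f) := by
    refine Subtype.ext ?_
    simp [mul_comm]
  have e3 : partialD 1 (d + 1) (mulX 1 (d + 1) g) + mulX 0 d (partialD 0 d g) =
      ((d + 2 : ℕ) : k) • g := by
    refine Subtype.ext ?_
    simp only [Submodule.coe_add, coe_mulX, coe_partialD, Submodule.coe_smul, smul_eq_C_mul,
      pderiv_mul, pderiv_X_self]
    have : C ((d + 2 : ℕ) : k) * g.1 = C ((d + 1 : ℕ) : k) * g.1 + g.1 := by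
      rw [show ((d + 2 : ℕ) : k) = ((d + 1 : ℕ) : k) + 1 by push_cast; ring, map_add, map_one,
        add_mul, one_mul]
    rw [this, ← hg]
    ring
  have e4 : partialD 0 (d + 1) (mulX 1 (d + 1) g) = mulX 1 d (partialD 0 d g) := by
    refine Subtype.ext ?_
    simp [mul_comm]
  rw [map_add, map_add, muL_lin, muL_lin, map_add (lambdaL k d), lambdaL_lin_zero, lambdaL_lin_one, map_add,
    deltaL_apply, deltaL_apply, map_neg, kappaL_apply, kappaL_apply, smul_add,
    TensorProduct.smul_tmul', TensorProduct.smul_tmul', ← e1, ← e3, e2, e4,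
    TensorProduct.add_tmul, TensorProduct.add_tmul]
  abel

theorem kappaL_injective (d : ℕ) : Function.Injective (kappaL k d) := by
  rw [injective_iff_map_eq_zero]
  intro f hf
  have h := congrArg (fun t => TensorProduct.rid k _ ((linCoord k 1).lTensor _ t)) hf
  simp only [kappaL_apply, map_sub, LinearMap.lTensor_tmul, linCoord_lin, map_zero] at h
  have h1 := congrArg Subtype.val h
  simpa using h1

end Maps

section Equivariance

variable {p : ℕ} {k : Type u} [Field k] [CharP k p]

theorem symRep_lin (g : SL2 p) (i : Fin 2) : symRep p k 1 g (lin k i) =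
    ZMod.castHom (dvd_refl p) k (g.1 0 i) • lin k 0 +
      ZMod.castHom (dvd_refl p) k (g.1 1 i) • lin k 1 := by
  refine Subtype.ext ?_
  rw [coe_symRep_apply]
  fin_cases i
  · simp [subst_X_zero, smul_eq_C_mul]
  · simp [subst_X_one, smul_eq_C_mul]

theorem symRep_mulX (g : SL2 p) (i : Fin 2) {d : ℕ} (f : Hom2 k d) :
    symRep p k (d + 1) g (mulX i d f) =
      ZMod.castHom (dvd_refl p) k (g.1 0 i) • mulX 0 d (symRep p k d g f) +
        ZMod.castHom (dvd_refl p) k (g.1 1 i) • mulX 1 d (symRep p k d g f) := by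
  refine Subtype.ext ?_
  fin_cases i
  · simp [coe_symRep_apply, subst_X_zero, smul_eq_C_mul]; ring
  · simp [coe_symRep_apply, subst_X_one, smul_eq_C_mul]; ring

/-- The chain rule for a linear substitution. -/
theorem pderiv_subst (M : Matrix (Fin 2) (Fin 2) (ZMod p)) (i : Fin 2)
    (f : MvPolynomial (Fin 2) k) : pderiv i (subst p k M f) =
      C (ZMod.castHom (dvd_refl p) k (M i 0)) * subst p k M (pderiv 0 f) +
        C (ZMod.castHom (dvd_refl p) k (M i 1)) * subst p k M (pderiv 1 f) := by
  induction f using MvPolynomial.induction_on with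
  | C a => simp [subst]
  | add f g hf hg => simp only [map_add, hf, hg]; ring
  | mul_X f j hf =>
    have hX : pderiv i (subst p k M (X j)) = C (ZMod.castHom (dvd_refl p) k (M i j)) := by
      fin_cases i <;> fin_cases j <;>
        simp [subst_X_zero, subst_X_one]
    rw [map_mul, pderiv_mul, hf, hX, pderiv_mul, pderiv_mul, map_add, map_add, map_mul, map_mul,
      map_mul, map_mul]
    fin_cases j
    · simp; ring
    · simp; ring

theorem partialD_symRep (g : SL2 p) (i : Fin 2) {d : ℕ} (f : Hom2 k (d + 1)) :
    partialD i d (symRep p k (d + 1) g f) =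
      ZMod.castHom (dvd_refl p) k (g.1 i 0) • symRep p k d g (partialD 0 d f) +
        ZMod.castHom (dvd_refl p) k (g.1 i 1) • symRep p k d g (partialD 1 d f) := by
  refine Subtype.ext ?_
  simp only [coe_partialD, coe_symRep_apply, pderiv_subst, Submodule.coe_add, Submodule.coe_smul,
    smul_eq_C_mul]

variable (p k)

/-- Multiplication by linear forms, as an intertwining map. -/
def muI (d : ℕ) :
    ((symRep p k d).tprod (symRep p k 1)).IntertwiningMap (symRep p k (d + 1)) where
  toLinearMap := muL k d
  isIntertwining' g := by
    refine LinearMap.ext fun t => ?_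
    induction t using tensor_induction with
    | h f g' =>
    simp only [LinearMap.comp_apply, map_add, Representation.tprod_apply, TensorProduct.map_tmul,
      symRep_lin, TensorProduct.tmul_add, TensorProduct.tmul_smul, map_smul, muL_lin, symRep_mulX]

/-- Polarization, as an intertwining map. -/
def deltaI (d : ℕ) :
    (symRep p k (d + 1)).IntertwiningMap ((symRep p k d).tprod (symRep p k 1)) where
  toLinearMap := deltaL k d
  isIntertwining' g := by
    refine LinearMap.ext fun f => ?_
    simp only [LinearMap.comp_apply, deltaL_apply, map_add, Representation.tprod_apply,
      TensorProduct.map_tmul, symRep_lin, TensorProduct.tmul_add, TensorProduct.tmul_smul,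
      partialD_symRep, TensorProduct.add_tmul, ← TensorProduct.smul_tmul']
    abel

/-- The Koszul map, as an intertwining map. -/
def kappaI (d : ℕ) :
    (symRep p k d).IntertwiningMap ((symRep p k (d + 1)).tprod (symRep p k 1)) where
  toLinearMap := kappaL k d
  isIntertwining' g := by
    refine LinearMap.ext fun f => ?_
    -- The group multiplies the tensor `X ⊗ Y - Y ⊗ X` by the determinant, here `1`.
    have hdet := congrArg (ZMod.castHom (dvd_refl p) k) g.2
    rw [Matrix.det_fin_two, map_sub, map_mul, map_mul, map_one] at hdet
    simp only [LinearMap.comp_apply, kappaL_apply, map_sub, Representation.tprod_apply,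
      TensorProduct.map_tmul, symRep_lin, TensorProduct.tmul_add, TensorProduct.tmul_smul,
      symRep_mulX, TensorProduct.add_tmul, ← TensorProduct.smul_tmul', smul_add, smul_smul]
    generalize mulX 0 d (symRep p k d g f) ⊗ₜ[k] lin k 0 = t00
    generalize mulX 0 d (symRep p k d g f) ⊗ₜ[k] lin k 1 = t01
    generalize mulX 1 d (symRep p k d g f) ⊗ₜ[k] lin k 0 = t10
    generalize mulX 1 d (symRep p k d g f) ⊗ₜ[k] lin k 1 = t11
    linear_combination (norm := module) hdet • (t10 - t01)

theorem kappaI_injective (d : ℕ) : Function.Injective (kappaI p k d) := kappaL_injective d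

/-- The Poisson bracket with linear forms, as an intertwining map. -/
def lambdaI (d : ℕ) :
    ((symRep p k (d + 1)).tprod (symRep p k 1)).IntertwiningMap (symRep p k d) where
  toLinearMap := lambdaL k d
  isIntertwining' g := by
    -- After the injective map `κ`, the bracket becomes `(d + 2) - δ μ`, which is visibly
    -- equivariant.
    refine LinearMap.ext fun t => kappaI_injective p k d ?_
    have key : ∀ t, kappaI p k d (lambdaL k d t) =
        ((d + 2 : ℕ) : k) • t - deltaI p k (d + 1) (muI p k (d + 1) t) := fun t =>
      eq_sub_of_add_eq' (deltaL_muL_add_kappaL_lambdaL t)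
    rw [LinearMap.comp_apply, LinearMap.comp_apply, key, (kappaI p k d).isIntertwining, key,
      (muI p k (d + 1)).isIntertwining, (deltaI p k (d + 1)).isIntertwining, map_sub, map_smul]

variable {p k}

/-- The Clebsch-Gordan decomposition `V_n ⊗ V_2 ≅ V_{n+1} ⊕ V_{n-1}`, where `p` does not divide
`n = d + 2`. -/
theorem splits_symRep (d : ℕ) (hd : ((d + 2 : ℕ) : k) ≠ 0) :
    Splits (Rep.of ((symRep p k (d + 1)).tprod (symRep p k 1))) (Rep.of (symRep p k (d + 2)))
      (Rep.of (symRep p k d)) := by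
  refine ⟨Rep.ofHom (((d + 2 : ℕ) : k)⁻¹ • deltaI p k (d + 1)), Rep.ofHom (muI p k (d + 1)),
    Rep.ofHom (kappaI p k d), Rep.ofHom (((d + 2 : ℕ) : k)⁻¹ • lambdaI p k d), ?_, ?_, ?_, ?_, ?_⟩
  · refine Rep.hom_ext (DFunLike.ext _ _ fun f => ?_)
    change muL k (d + 1) (((d + 2 : ℕ) : k)⁻¹ • deltaL k (d + 1) f) = f
    rw [map_smul, muL_deltaL, smul_smul, inv_mul_cancel₀ hd, one_smul]
  · refine Rep.hom_ext (DFunLike.ext _ _ fun f => ?_)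
    change ((d + 2 : ℕ) : k)⁻¹ • lambdaL k d (kappaL k d f) = f
    rw [lambdaL_kappaL, smul_smul, inv_mul_cancel₀ hd, one_smul]
  · refine Rep.hom_ext (DFunLike.ext _ _ fun f => ?_)
    change ((d + 2 : ℕ) : k)⁻¹ • lambdaL k d (((d + 2 : ℕ) : k)⁻¹ • deltaL k (d + 1) f) = 0
    rw [map_smul, lambdaL_deltaL, smul_zero, smul_zero]
  · exact Rep.hom_ext (DFunLike.ext _ _ fun f => muL_kappaL f)
  · refine Rep.hom_ext (DFunLike.ext _ _ fun t => ?_)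
    change ((d + 2 : ℕ) : k)⁻¹ • deltaL k (d + 1) (muL k (d + 1) t) +
      kappaL k d (((d + 2 : ℕ) : k)⁻¹ • lambdaL k d t) = t
    rw [map_smul, ← smul_add, deltaL_muL_add_kappaL_lambdaL, smul_smul, inv_mul_cancel₀ hd,
      one_smul]

end Equivariance

end ClebschGordan

/-! ### Tensoring with `V_{p-1}` in the stable category -/

section Omega

universe u v w

open CategoryTheory in
theorem Splits.symm {C : Type*} [Category* C] [Preadditive C] {X A B : C} (h : Splits X A B) :
    Splits X B A := by
  obtain ⟨i, p, j, q, h1, h2, h3, h4, h5⟩ := h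
  exact ⟨j, q, i, p, h2, h1, h4, h3, by rw [add_comm, h5]⟩

section General

variable {k : Type u} [Field k] {G : Type v} [Group G] [Fintype G]
variable {V : Type w} [AddCommGroup V] [Module k V] {ρ : Representation k G V}
variable {W : Type w} [AddCommGroup W] [Module k W] {σ : Representation k G W}
variable {U : Type w} [AddCommGroup U] [Module k U] {τ : Representation k G U}

theorem StableIso.of_splits (h : Splits (Rep.of ρ) (Rep.of σ) (Rep.of τ)) (hσ : IsProjective σ) :
    StableIso ρ τ := by
  obtain ⟨i, p, j, q, h1, h2, h3, h4, h5⟩ := h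
  have hp : IsTrace p.hom :=
    ((isProjective_iff_isTrace_id.1 hσ).comp_right p.hom).congr fun v => rfl
  refine ⟨q.hom, j.hom, ((hp.comp_left i.hom).neg).congr fun v => ?_, IsTrace.zero.congr fun v => ?_⟩
  · have := congrArg (fun f => Rep.Hom.hom f v) h5
    simp only [Rep.add_hom, Rep.hom_comp, Rep.hom_id] at this
    change i.hom (p.hom v) + j.hom (q.hom v) = v at this
    change j.hom (q.hom v) - v = - i.hom (p.hom v)
    rw [← neg_sub, neg_inj]
    exact sub_eq_of_eq_add this.symm
  · have := congrArg (fun f => Rep.Hom.hom f v) h2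
    change q.hom (j.hom v) = v at this
    change q.hom (j.hom v) - v = 0
    rw [this, sub_self]

variable {A A₀ A₂ B B₀ B₂ C : Type w} [AddCommGroup A] [Module k A] [AddCommGroup A₀] [Module k A₀]
  [AddCommGroup A₂] [Module k A₂] [AddCommGroup B] [Module k B] [AddCommGroup B₀] [Module k B₀]
  [AddCommGroup B₂] [Module k B₂] [AddCommGroup C] [Module k C]
  {α : Representation k G A} {α₀ : Representation k G A₀} {α₂ : Representation k G A₂}
  {β : Representation k G B} {β₀ : Representation k G B₀} {β₂ : Representation k G B₂}
  {γ : Representation k G C}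

/-- The inductive step of the reflection: `τ ⊗ α ⊗ γ` is stably `β ⊗ γ`, so `(τ ⊗ α₂) ⊕ (τ ⊗ α₀)` is
stably `β₂ ⊕ β₀`, and `τ ⊗ α₀ ~ β₀` cancels. -/
theorem StableIso.tprod_of_splits (h : Splits (Rep.of (α.tprod γ)) (Rep.of α₂) (Rep.of α₀))
    (h' : Splits (Rep.of (β.tprod γ)) (Rep.of β₂) (Rep.of β₀)) (h1 : StableIso (τ.tprod α) β)
    (h0 : StableIso (τ.tprod α₀) β₀)
    (hS : ∀ f : β₀.IntertwiningMap β₀, f = 0 ∨ Function.Bijective f) :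
    StableIso (τ.tprod α₂) β₂ :=
  StableIso.cancel (splits_lTensor τ h) h'
    ((StableIso.of_equiv (Representation.TensorProduct.assoc τ α γ).symm).trans (h1.rTensor γ))
    h0 hS

end General

variable {p : ℕ} {k : Type u} [Field k] [CharP k p]

theorem symRep_zero_apply (g : SL2 p) (f : Hom2 k 0) : symRep p k 0 g f = f := by
  refine Subtype.ext ?_
  obtain ⟨c, hc⟩ : ∃ c : k, f.1 = C c := by
    have h := (mem_homogeneousSubmodule _ _).1 f.2
    exact ⟨coeff 0 f.1, (totalDegree_eq_zero_iff_eq_C).1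
      (Nat.le_zero.1 h.totalDegree_le)⟩
  rw [coe_symRep_apply, hc, algHom_C]
  rfl

/-- `V_1` is the trivial module. -/
def symRepZeroEquiv (p : ℕ) (k : Type u) [Field k] [CharP k p] :
    (symRep p k 0).Equiv (Representation.trivial k (SL2 p) k) :=
  .mk (LinearEquiv.ofFinrankEq _ _ (by rw [finrank_hom2, Module.finrank_self])) fun g =>
    LinearMap.ext fun f => by
      simp [symRep_zero_apply]

theorem stableIso_tprod_symRep_zero [Fact p.Prime] {W : Type u} [AddCommGroup W] [Module k W]
    (σ : Representation k (SL2 p) W) : StableIso (σ.tprod (symRep p k 0)) σ :=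
  ((StableIso.of_equiv (symRepZeroEquiv p k)).lTensor σ).trans
    (StableIso.of_equiv (Representation.TensorProduct.rid k σ))

variable [Fact p.Prime]

/-- In terms of dimensions, `V_{p-1} ⊗ V_{a+1} ~ V_{b+1}` with `(a + 1) + (b + 1) = p`. The bound `d
+ 2 < p` keeps every Clebsch-Gordan denominator invertible. -/
theorem stableIso_symRep_aux (hp : 2 < p) (a : ℕ) : ∀ b, a + b = p - 2 →
    StableIso ((symRep p k (p - 2)).tprod (symRep p k a)) (symRep p k b) := by
  have hne : ∀ d, d + 2 < p → ((d + 2 : ℕ) : k) ≠ 0 := fun d hd h =>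
    absurd (Nat.le_of_dvd (by omega) ((CharP.cast_eq_zero_iff k p _).1 h)) (by omega)
  induction a using Nat.strong_induction_on with
  | _ a ih =>
  match a with
  | 0 =>
    intro b hb
    obtain rfl : b = p - 2 := by omega
    exact stableIso_tprod_symRep_zero _
  | 1 =>
    intro b hb
    obtain ⟨d, rfl⟩ : ∃ d, p = d + 3 := ⟨p - 3, by omega⟩
    obtain rfl : b = d := by omega
    exact StableIso.of_splits (splits_symRep b (hne _ (by omega))) symRep_isProjective
  | c + 2 =>
    intro e he
    -- Raising the index on the left lowers it on the right, so the second splitting is swapped: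
    -- `V_{e+3}` cancels and `V_{e+1}` remains.
    exact StableIso.tprod_of_splits (splits_symRep c (hne _ (by omega)))
      (splits_symRep e (hne _ (by omega))).symm
      (ih (c + 1) (by omega) (e + 1) (by omega)) (ih c (by omega) (e + 2) (by omega))
      (fun f => symRep_eq_zero_or_bijective (by omega) f)

end Omega

open scoped DirectSum

/-! ### Multiplicities in the stable category -/

section Multiplicity

universe u v w

section General

variable {k : Type*} [Field k] {G : Type*} [Group G]
variable {V : Type*} [AddCommGroup V] [Module k V] {ρ : Representation k G V}
variable {V' : Type*} [AddCommGroup V'] [Module k V'] {ρ' : Representation k G V'}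
variable {W : Type*} [AddCommGroup W] [Module k W] {σ : Representation k G W}
variable {W' : Type*} [AddCommGroup W'] [Module k W'] {σ' : Representation k G W'}
variable {U : Type*} [AddCommGroup U] [Module k U] {τ : Representation k G U}

theorem isSummand_directSum_iff {m : ℕ} :
    IsSummand (Representation.directSum fun _ : Fin m => σ) ρ ↔
      ∃ (a : Fin m → σ.IntertwiningMap ρ) (b : Fin m → ρ.IntertwiningMap σ),
        ∀ i j x, b j (a i x) = if i = j then x else 0 := by
  rw [isSummand_iff_exists]
  let ι (i : Fin m) : σ.IntertwiningMap (Representation.directSum fun _ : Fin m => σ) :=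
    { toLinearMap := DirectSum.lof k (Fin m) (fun _ => W) i
      isIntertwining' := fun g => by ext x; simp [Representation.directSum] }
  let π (i : Fin m) : (Representation.directSum fun _ : Fin m => σ).IntertwiningMap σ :=
    { toLinearMap := DirectSum.component k (Fin m) (fun _ => W) i
      isIntertwining' := fun g => LinearMap.ext fun x => by
        change DirectSum.lmap (fun _ => σ g) x i = σ g (x i)
        rw [DirectSum.lmap_apply] }
  have hπι : ∀ i j x, π j (ι i x) = if i = j then x else 0 := fun i j x => by
    change DirectSum.component k (Fin m) (fun _ => W) j (DirectSum.lof k (Fin m) (fun _ => W) i x) = _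
    rw [DirectSum.component.of]
    split_ifs with h
    · subst h; rfl
    · rfl
  have hsum : ∀ x, ∑ i, ι i (π i x) = x := fun x => by
    refine DirectSum.ext_component k fun j => ?_
    rw [map_sum]
    change ∑ i, π j (ι i (π i x)) = π j x
    simp [hπι]
  constructor
  · rintro ⟨a, b, h⟩
    refine ⟨fun i => a.comp (ι i), fun j => (π j).comp b, fun i j x => ?_⟩
    change π j (b (a (ι i x))) = _
    rw [h, hπι]
  · rintro ⟨a, b, h⟩
    refine ⟨∑ i, (a i).comp (π i), ∑ j, (ι j).comp (b j), fun x => ?_⟩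
    simp only [IntertwiningMap.sum_apply, IntertwiningMap.comp_apply, map_sum, h]
    conv_rhs => rw [← hsum x]
    refine Finset.sum_congr rfl fun j _ => ?_
    simp [apply_ite (ι _)]

variable [Fintype G]

/-- In the stable category, the direct sum of `m` copies of `σ` is a direct summand of `ρ`. -/
def IsStableSummand (m : ℕ) (σ : Representation k G W) (ρ : Representation k G V) : Prop :=
  ∃ (a : Fin m → σ.IntertwiningMap ρ) (b : Fin m → ρ.IntertwiningMap σ),
    ∀ i j, IsTrace ((b j).comp (a i) - if i = j then IntertwiningMap.id σ else 0)

/-- The hypothesis makes `End σ` embed in the stable endomorphisms, so the relations `b_j a_i =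
δ_ij` hold exactly as soon as they hold stably. -/
theorem isSummand_directSum_iff_isStableSummand
    (hσ : ∀ f : σ.IntertwiningMap σ, IsTrace f → f = 0) {m : ℕ} :
    IsSummand (Representation.directSum fun _ : Fin m => σ) ρ ↔ IsStableSummand m σ ρ := by
  rw [isSummand_directSum_iff]
  refine exists₂_congr fun a b => forall₂_congr fun i j => ⟨fun h => ?_, fun h x => ?_⟩
  · refine IsTrace.zero.congr fun v => ?_
    rw [IntertwiningMap.coe_sub, Pi.sub_apply, IntertwiningMap.comp_apply, h]
    split_ifs <;> simp
  · have := sub_eq_zero.1 (hσ _ h)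
    rw [← IntertwiningMap.comp_apply, this]
    split_ifs <;> simp

theorem isSummand_iff_isStableSummand (hσ : ∀ f : σ.IntertwiningMap σ, IsTrace f → f = 0) :
    IsSummand σ ρ ↔ IsStableSummand 1 σ ρ := by
  rw [← isSummand_directSum_iff_isStableSummand hσ, isSummand_directSum_iff, isSummand_iff_exists]
  constructor
  · rintro ⟨a, b, h⟩
    exact ⟨fun _ => a, fun _ => b, fun i j x => by rw [h, if_pos (Subsingleton.elim i j)]⟩
  · rintro ⟨a, b, h⟩
    exact ⟨a 0, b 0, fun x => by rw [h, if_pos rfl]⟩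

theorem summandMultiplicity_eq (hσ : ∀ f : σ.IntertwiningMap σ, IsTrace f → f = 0) :
    summandMultiplicity σ ρ = sSup {m | IsStableSummand m σ ρ} := by
  simp only [summandMultiplicity, isSummand_directSum_iff_isStableSummand hσ]

theorem IsStableSummand.of_stableIso_right {m : ℕ} (h : IsStableSummand m σ ρ)
    (e : StableIso ρ ρ') : IsStableSummand m σ ρ' := by
  obtain ⟨a, b, h⟩ := h
  obtain ⟨u, v, hvu, -⟩ := e
  refine ⟨fun i => u.comp (a i), fun j => (b j).comp v, fun i j => ?_⟩
  refine (((hvu.comp_left (b j)).comp_right (a i)).add (h i j)).congr fun x => ?_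
  simp [IntertwiningMap.coe_sub]

theorem IsStableSummand.of_stableIso_left {m : ℕ} (h : IsStableSummand m σ ρ)
    (e : StableIso σ σ') : IsStableSummand m σ' ρ := by
  obtain ⟨a, b, h⟩ := h
  obtain ⟨u, v, -, huv⟩ := e
  refine ⟨fun i => (a i).comp v, fun j => u.comp (b j), fun i j => ?_⟩
  have h1 := ((h i j).comp_left u).comp_right v
  split_ifs at h1 ⊢ with hij
  · refine (h1.add huv).congr fun x => ?_
    simp [IntertwiningMap.coe_sub]
  · refine h1.congr fun x => ?_
    simp

theorem IsStableSummand.lTensor {m : ℕ} (h : IsStableSummand m σ ρ) (τ : Representation k G U) :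
    IsStableSummand m (τ.tprod σ) (τ.tprod ρ) := by
  obtain ⟨a, b, h⟩ := h
  refine ⟨fun i => IntertwiningMap.lTensor τ (a i), fun j => IntertwiningMap.lTensor τ (b j),
    fun i j => ((h i j).lTensor τ).congr fun x => ?_⟩
  induction x using TensorProduct.induction_on with
  | zero => simp
  | add x y hx hy => rw [map_add, map_add, hx, hy]
  | tmul x y =>
    split_ifs <;> simp [IntertwiningMap.coe_sub, TensorProduct.tmul_sub]

end General

section Tensor

variable {k : Type u} [Field k] {G : Type v} [Group G] [Fintype G]
variable {V : Type w} [AddCommGroup V] [Module k V] {α : Representation k G V}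
variable {V' : Type w} [AddCommGroup V'] [Module k V'] {β : Representation k G V'}
variable {W : Type w} [AddCommGroup W] [Module k W] {γ : Representation k G W}
variable {W' : Type w} [AddCommGroup W'] [Module k W'] {δ : Representation k G W'}
variable {U : Type w} [AddCommGroup U] [Module k U] {ω : Representation k G U}

/-- The factor `ω` migrates across the tensor product: `α ⊗ γ ~ α ⊗ (ω ⊗ δ) ≅ (α ⊗ ω) ⊗ δ ~ β ⊗ δ`.
-/
theorem StableIso.tprod_swap (h : StableIso (ω.tprod α) β) (h' : StableIso (ω.tprod δ) γ) :
    StableIso (α.tprod γ) (β.tprod δ) := by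
  refine (h'.symm.lTensor α).trans ?_
  refine (StableIso.of_equiv (Representation.TensorProduct.assoc α ω δ).symm).trans ?_
  exact StableIso.rTensor δ
    ((StableIso.of_equiv (Representation.TensorProduct.comm α ω)).trans h)

theorem StableIso.tprod_assoc (h : StableIso (ω.tprod α) β) (γ : Representation k G W) :
    StableIso (ω.tprod (α.tprod γ)) (β.tprod γ) :=
  (StableIso.of_equiv (Representation.TensorProduct.assoc ω α γ).symm).trans (h.rTensor γ)

end Tensor

section SL2

variable {p : ℕ} {k : Type u} [Field k] [CharP k p] [Fact p.Prime]

theorem V_isTrace_eq_zero {n : ℕ} (hn : n ∈ Set.Icc 1 (p - 1))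
    {f : (V p k n).IntertwiningMap (V p k n)} (hf : IsTrace f) : f = 0 := by
  obtain ⟨d, rfl⟩ : ∃ d, n = d + 1 := ⟨n - 1, by have := hn.1; omega⟩
  exact symRep_isTrace_eq_zero (by have := hn.1; have := hn.2; omega) hf

theorem stableIso_V (hp : 2 < p) {n : ℕ} (hn : n ∈ Set.Icc 1 (p - 1)) :
    StableIso ((V p k (p - 1)).tprod (V p k n)) (V p k (p - n)) := by
  obtain ⟨h1, h2⟩ := hn
  obtain ⟨d, rfl⟩ : ∃ d, n = d + 1 := ⟨n - 1, by omega⟩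
  obtain ⟨q, rfl⟩ : ∃ q, p = q + 2 := ⟨p - 2, by omega⟩
  obtain ⟨b, hb⟩ : ∃ b, q + 2 - (d + 1) = b + 1 := ⟨q - d, by omega⟩
  rw [hb]
  exact stableIso_symRep_aux hp d b (by omega)

omit [Fact p.Prime] in
theorem sub_mem_Icc {n : ℕ} (hn : n ∈ Set.Icc 1 (p - 1)) : p - n ∈ Set.Icc 1 (p - 1) := by
  obtain ⟨h1, h2⟩ := hn
  constructor <;> omega

theorem stableIso_VV (hp : 2 < p) {i j : ℕ} (hi : i ∈ Set.Icc 1 (p - 1))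
    (hj : j ∈ Set.Icc 1 (p - 1)) : StableIso (VV p k i j) (VV p k (p - i) (p - j)) := by
  have h := stableIso_V (k := k) hp (sub_mem_Icc hj)
  have h1 := hj.1
  have h2 := hj.2
  rw [show p - (p - j) = j by omega] at h
  exact StableIso.tprod_swap (stableIso_V hp hi) h

/-- Tensoring with `V_{p-1}` reflects both `V_j` and the first factor `V_i`. -/
theorem IsStableSummand.V_shift (hp : 2 < p) {i j n m : ℕ} (hi : i ∈ Set.Icc 1 (p - 1))
    (hj : j ∈ Set.Icc 1 (p - 1)) (h : IsStableSummand m (V p k j) (VV p k i n)) :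
    IsStableSummand m (V p k (p - j)) (VV p k (p - i) n) :=
  ((h.lTensor (V p k (p - 1))).of_stableIso_left (stableIso_V hp hj)).of_stableIso_right
    (StableIso.tprod_assoc (stableIso_V hp hi) _)

theorem isSummand_VV_iff (hp : 2 < p) {i j l : ℕ} (hi : i ∈ Set.Icc 1 (p - 1))
    (hj : j ∈ Set.Icc 1 (p - 1)) (hl : l ∈ Set.Icc 1 (p - 1)) :
    IsSummand (V p k l) (VV p k i j) ↔ IsSummand (V p k l) (VV p k (p - i) (p - j)) := by
  rw [isSummand_iff_isStableSummand fun f hf => V_isTrace_eq_zero hl hf,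
    isSummand_iff_isStableSummand fun f hf => V_isTrace_eq_zero hl hf]
  exact ⟨fun h => h.of_stableIso_right (stableIso_VV hp hi hj),
    fun h => h.of_stableIso_right (stableIso_VV hp hi hj).symm⟩

/-- The involution `i ↦ p - i`. -/
def Idx.flip (p : ℕ) : Equiv.Perm (Idx p) :=
  have h : Function.Involutive fun i : Idx p => (⟨p - i, by
      have := i.2.1; have := i.2.2; constructor <;> omega⟩ : Idx p) := fun i => by
    have := i.2.1; have := i.2.2
    exact Subtype.ext (show p - (p - (i : ℕ)) = i by omega)
  h.toPerm

omit [Fact p.Prime] in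
theorem Idx.coe_flip (i : Idx p) : (Idx.flip p i : ℕ) = p - i := rfl

omit [Fact p.Prime] in
theorem Idx.flip_flip (i : Idx p) : Idx.flip p (Idx.flip p i) = i := by
  have := i.2.1; have := i.2.2
  exact Subtype.ext (show p - (p - (i : ℕ)) = i by omega)

omit [Fact p.Prime] in
theorem Idx.add_eq_iff (i j : Idx p) : (i : ℕ) + j = p ↔ j = Idx.flip p i := by
  have := i.2.1; have := i.2.2; have := j.2.1; have := j.2.2
  rw [Subtype.ext_iff, Idx.coe_flip]
  omega

theorem A_flip_left (hp : 2 < p) (i j : Idx p) {n : ℕ} (hn : n ∈ Set.Icc 1 (p - 1)) :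
    A p k (p - n) (Idx.flip p i) j = A p k n i j := by
  simp only [A, Matrix.of_apply]
  rw [summandMultiplicity_eq fun f hf => V_isTrace_eq_zero j.2 hf,
    summandMultiplicity_eq fun f hf => V_isTrace_eq_zero j.2 hf]
  congr 1
  ext m
  exact ⟨fun h => h.of_stableIso_right (stableIso_VV hp i.2 hn).symm,
    fun h => h.of_stableIso_right (stableIso_VV hp i.2 hn)⟩

theorem A_flip_flip (hp : 2 < p) (i j : Idx p) (n : ℕ) :
    A p k n (Idx.flip p i) (Idx.flip p j) = A p k n i j := by
  simp only [A, Matrix.of_apply]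
  rw [summandMultiplicity_eq fun f hf => V_isTrace_eq_zero j.2 hf,
    summandMultiplicity_eq fun f hf => V_isTrace_eq_zero (Idx.flip p j).2 hf]
  congr 1
  ext m
  refine ⟨fun h => ?_, fun h => IsStableSummand.V_shift hp i.2 j.2 h⟩
  have h := IsStableSummand.V_shift hp (Idx.flip p i).2 (Idx.flip p j).2 h
  rwa [← Idx.coe_flip, ← Idx.coe_flip, Idx.flip_flip, Idx.flip_flip] at h

omit [Fact p.Prime] in
theorem Idx.add_eq_iff' (i j : Idx p) : (i : ℕ) + j = p ↔ i = Idx.flip p j := by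
  rw [add_comm, Idx.add_eq_iff]

omit [Fact p.Prime] in
theorem T_mul_apply (M : Matrix (Idx p) (Idx p) ℕ) (i j : Idx p) :
    (T p * M) i j = M (Idx.flip p i) j := by
  simp [Matrix.mul_apply, T, Idx.add_eq_iff]

omit [Fact p.Prime] in
theorem mul_T_apply (M : Matrix (Idx p) (Idx p) ℕ) (i j : Idx p) :
    (M * T p) i j = M i (Idx.flip p j) := by
  simp [Matrix.mul_apply, T, Idx.add_eq_iff']

theorem T_mul_A (hp : 2 < p) {n : ℕ} (hn : n ∈ Set.Icc 1 (p - 1)) :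
    A p k n = T p * A p k (p - n) := by
  ext i j
  rw [T_mul_apply]
  exact (A_flip_left hp i j hn).symm

theorem T_mul_A_mul_T (hp : 2 < p) (n : ℕ) : T p * A p k n * T p = A p k n := by
  ext i j
  rw [mul_T_apply, T_mul_apply]
  exact A_flip_flip hp i j n

omit [Fact p.Prime] in
theorem T_mul_T : T p * T p = 1 := by
  ext i j
  rw [T_mul_apply, Matrix.one_apply]
  simp only [T, Matrix.of_apply, Idx.add_eq_iff, Idx.flip_flip, eq_comm (a := j)]

theorem T_mul_A_comm (hp : 2 < p) (n : ℕ) : T p * A p k n = A p k n * T p := by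
  conv_rhs => rw [← T_mul_A_mul_T hp, Matrix.mul_assoc, T_mul_T, Matrix.mul_one]

/-- The automorphism `i ↦ p - i` of the graph. -/
def graphFlip (k : Type u) [Field k] [CharP k p] (hp : 2 < p) (n : ℕ) :
    (graph p k n).Adj ≃r (graph p k n).Adj where
  toEquiv := Idx.flip p
  map_rel_iff' {i j} := by
    change A p k n _ _ ≠ 0 ↔ A p k n i j ≠ 0
    rw [A_flip_flip hp i j n]

theorem even_coe_flip (hp : 2 < p) (i : Idx p) : Odd (Idx.flip p i : ℕ) ↔ Even (i : ℕ) := by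
  have hodd : Odd p := (Fact.out : p.Prime).odd_of_ne_two hp.ne'
  have := i.2.1; have := i.2.2
  rw [Idx.coe_flip, Nat.odd_sub (by omega)]
  simp [hodd]

theorem nonempty_inducedSubgraph_iso (hp : 2 < p) (n : ℕ) : Nonempty
    ((inducedSubgraph (graph p k n) {i | Even (i : ℕ)}).Adj ≃r
      (inducedSubgraph (graph p k n) {i | Odd (i : ℕ)}).Adj) :=
  ⟨{ toEquiv := (Idx.flip p).subtypeEquiv fun i => (even_coe_flip hp i).symm
     map_rel_iff' := (graphFlip k hp n).map_rel_iff }⟩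

end SL2

end Multiplicity

/-! ### Every nonzero module contains some `V_n` with `n ≤ p` -/

section Socle

universe u v w

theorem exists_comp_eq {k : Type*} [Field k] {G : Type*} [Group G]
    {V W U : Type*} [AddCommGroup V] [Module k V] [AddCommGroup W] [Module k W]
    [AddCommGroup U] [Module k U] {ρ : Representation k G V} {σ : Representation k G W}
    {τ : Representation k G U} {π : ρ.IntertwiningMap σ} (hπ : Function.Surjective π)
    (f : ρ.IntertwiningMap τ) (h : ∀ x, π x = 0 → f x = 0) :
    ∃ f' : σ.IntertwiningMap τ, ∀ x, f' (π x) = f x := by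
  obtain ⟨s, hs⟩ := π.toLinearMap.exists_rightInverse_of_surjective (LinearMap.range_eq_top.2 hπ)
  have hs : ∀ y, π (s y) = y := fun y => LinearMap.congr_fun hs y
  have key : ∀ x, f (s (π x)) = f x := fun x => by
    rw [← sub_eq_zero, ← map_sub, h]
    rw [map_sub, hs, sub_self]
  refine ⟨{ toLinearMap := f.toLinearMap ∘ₗ s, isIntertwining' := fun g => LinearMap.ext fun y => ?_ },
    key⟩
  obtain ⟨x, rfl⟩ := hπ y
  change f (s (σ g (π x))) = τ g (f (s (π x)))
  rw [← π.isIntertwining, key, key, f.isIntertwining]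

theorem exists_comp_eq_of_injective {k : Type*} [Field k] {G : Type*} [Group G]
    {V W U : Type*} [AddCommGroup V] [Module k V] [AddCommGroup W] [Module k W]
    [AddCommGroup U] [Module k U] {ρ : Representation k G V} {σ : Representation k G W}
    {τ : Representation k G U} {ι : σ.IntertwiningMap τ} (hι : Function.Injective ι)
    (f : ρ.IntertwiningMap τ) (h : ∀ x, ∃ y, ι y = f x) :
    ∃ f' : ρ.IntertwiningMap σ, ∀ x, ι (f' x) = f x := by
  obtain ⟨r, hr⟩ := ι.toLinearMap.exists_leftInverse_of_injective (LinearMap.ker_eq_bot.2 hι)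
  have hr : ∀ y, r (ι y) = y := fun y => LinearMap.congr_fun hr y
  have key : ∀ x, ι (r (f x)) = f x := fun x => by
    obtain ⟨y, hy⟩ := h x
    rw [← hy, hr]
  refine ⟨{ toLinearMap := r ∘ₗ f.toLinearMap, isIntertwining' := fun g => LinearMap.ext fun x => ?_ },
    key⟩
  refine hι ?_
  change ι (r (f (ρ g x))) = ι (σ g (r (f x)))
  rw [ι.isIntertwining, key, key, f.isIntertwining]

section Maps

variable {k : Type u} [Field k]

theorem muL_surjective (d : ℕ) : Function.Surjective (muL k d) := by
  rw [← LinearMap.range_eq_top, eq_top_iff, ← (monoBasis k (d + 1)).span_eq, Submodule.span_le]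
  rintro _ ⟨j, rfl⟩
  rw [monoBasis_apply]
  have hj := j.2
  by_cases h : (j : ℕ) = 0
  · refine ⟨⟨X 0 ^ d * X 1 ^ 0, X_pow_mul_mem (by omega)⟩ ⊗ₜ lin k 0, ?_⟩
    rw [muL_lin]
    refine Subtype.ext ?_
    rw [coe_mulX, mono]
    simp only [h]
    simp [pow_succ]
  · refine ⟨⟨X 0 ^ (d + 1 - j : ℕ) * X 1 ^ (j - 1 : ℕ), X_pow_mul_mem (by omega)⟩ ⊗ₜ lin k 1, ?_⟩
    rw [muL_lin]
    refine Subtype.ext ?_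
    rw [coe_mulX, mono]
    change X 0 ^ (d + 1 - j : ℕ) * X 1 ^ (j - 1 : ℕ) * X 1 = X 0 ^ (d + 1 - j : ℕ) * X 1 ^ (j : ℕ)
    rw [mul_assoc, ← pow_succ, Nat.sub_add_cancel (by omega)]

/-- Exactness of the Koszul complex by dimension count: `2 (d + 2) = (d + 3) + (d + 1)`. -/
theorem range_kappaL (d : ℕ) : LinearMap.range (kappaL k d) = LinearMap.ker (muL k (d + 1)) := by
  refine Submodule.eq_of_le_of_finrank_eq ?_ ?_
  · rintro _ ⟨f, rfl⟩
    exact muL_kappaL f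
  · have h1 := LinearMap.finrank_range_of_inj (kappaL_injective (k := k) d)
    have h2 := LinearMap.finrank_range_add_finrank_ker (muL k (d + 1))
    rw [LinearMap.range_eq_top.2 (muL_surjective _), finrank_top, Module.finrank_tensorProduct,
      finrank_hom2, finrank_hom2, finrank_hom2] at h2
    rw [h1, finrank_hom2]
    omega

theorem pderiv_one_eq_zero_of_deltaL {d : ℕ} {f : Hom2 k (d + 1)} (hf : deltaL k d f = 0) :
    pderiv 1 f.1 = 0 := by
  have h := congrArg (fun t => TensorProduct.rid k _ ((linCoord k 1).lTensor _ t)) hf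
  simp only [deltaL_apply, map_add, LinearMap.lTensor_tmul, linCoord_lin, map_zero] at h
  simpa using congrArg Subtype.val h

end Maps

variable {p : ℕ} {k : Type u} [Field k] [CharP k p]

/-- The Frobenius map `V_2 → V_{p+1}`. -/
def frobI (p : ℕ) [Fact p.Prime] (k : Type u) [Field k] [CharP k p] :
    (symRep p k 1).IntertwiningMap (symRep p k p) where
  toLinearMap :=
    (LinearMap.toSpanSingleton k (Hom2 k p) ⟨X 0 ^ p, isHomogeneous_X_pow 0 p⟩).comp (linCoord k 0) +
    (LinearMap.toSpanSingleton k (Hom2 k p) ⟨X 1 ^ p, isHomogeneous_X_pow 1 p⟩).comp (linCoord k 1)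
  isIntertwining' g := by
    -- Matrix entries in the prime field are fixed by Frobenius, so the Frobenius twist of `V_2` is
    -- `V_2` itself.
    have hF : ∀ a : ZMod p, (ZMod.castHom (dvd_refl p) k a) ^ p = ZMod.castHom (dvd_refl p) k a :=
      fun a => by rw [← map_pow, ZMod.pow_card]
    have h : ∀ i : Fin 2, (subst p k g.1 (X i)) ^ p =
        C (ZMod.castHom (dvd_refl p) k (g.1 0 i)) * X 0 ^ p +
          C (ZMod.castHom (dvd_refl p) k (g.1 1 i)) * X 1 ^ p := fun i => by
      fin_cases i
      · simp only [Fin.zero_eta, subst_X_zero]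
        rw [add_pow_char, mul_pow, mul_pow, ← C_pow, ← C_pow, hF, hF]
      · simp only [Fin.mk_one, subst_X_one]
        rw [add_pow_char, mul_pow, mul_pow, ← C_pow, ← C_pow, hF, hF]
    refine LinearMap.ext fun l => ?_
    rw [eq_linCoord l]
    simp only [LinearMap.comp_apply, map_add, map_smul, symRep_lin]
    congr 1
    all_goals
      congr 1
      refine Subtype.ext ?_
      simp [coe_symRep_apply, h, smul_eq_C_mul]

theorem frobI_lin [Fact p.Prime] (i : Fin 2) :
    frobI p k (lin k i) = ⟨X i ^ p, isHomogeneous_X_pow i p⟩ := by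
  change linCoord k 0 (lin k i) • (⟨X 0 ^ p, isHomogeneous_X_pow 0 p⟩ : Hom2 k p) +
    linCoord k 1 (lin k i) • (⟨X 1 ^ p, isHomogeneous_X_pow 1 p⟩ : Hom2 k p) = _
  fin_cases i <;> simp

/-- Vanishing of `∂_Y` in degree `p` kills each monomial `X ^ (p - j) Y ^ j` with `0 < j < p`,
because `j` is invertible. Only `X ^ p` and `Y ^ p` remain. -/
theorem exists_frobI_eq [Fact p.Prime] {f : Hom2 k p} (h1 : pderiv 1 f.1 = 0) :
    ∃ l, frobI p k l = f := by
  have hp := (Fact.out : p.Prime).pos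
  refine ⟨coeff (expo p 0) f.1 • lin k 0 + coeff (expo 0 p) f.1 • lin k 1, Subtype.ext ?_⟩
  have key : ∀ j, j < p → j ≠ 0 → coeff (expo (p - j) j) f.1 = 0 := fun j hj hj0 => by
    have := congrArg (coeff (expo (p - j) (j - 1))) h1
    rw [coeff_pderiv, coeff_zero, expo_one] at this
    have e : expo (p - j) (j - 1) + Finsupp.single 1 1 = expo (p - j) j := by
      rw [expo, add_assoc, ← Finsupp.single_add, Nat.sub_add_cancel (by omega), expo]
    rw [e] at this
    refine (mul_eq_zero.1 this).resolve_right fun h => ?_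
    have h : ((j : ℕ) : k) = 0 := by
      rw [← h]; norm_cast; congr 1; omega
    exact absurd (Nat.le_of_dvd (by omega) ((CharP.cast_eq_zero_iff k p _).1 h)) (by omega)
  conv_rhs => rw [eq_sum_coeff f.2]
  rw [Finset.sum_range_succ, Finset.sum_eq_single 0]
  · rw [map_add, map_smul, map_smul, frobI_lin, frobI_lin]
    simp [smul_eq_C_mul]
  · intro j hj hj0
    rw [key j (by simpa using hj) hj0]
    simp
  · simp [hp.ne']

variable {W : Type*} [AddCommGroup W] [Module k W]

/-- No `V_n` with `1 ≤ n ≤ p` maps nontrivially to `σ`. -/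
def VFree (σ : Representation k (SL2 p) W) : Prop :=
  ∀ d < p, ∀ f : (symRep p k d).IntertwiningMap σ, f = 0

theorem VFree.apply_eq_zero {σ : Representation k (SL2 p) W} (hσ : VFree σ) {d : ℕ} (hd : d < p)
    (f : (symRep p k d).IntertwiningMap σ) (x : Hom2 k d) : f x = 0 := by
  rw [hσ d hd f]
  rfl

variable [Fact p.Prime]

/-- There is an extension of `V_{p-1}` by the Frobenius copy of `V_2` whose middle term is
`V_{p+1}`, and both ends map trivially to `σ`. -/
theorem VFree.symRep_self_eq_zero {σ : Representation k (SL2 p) W} (hσ : VFree σ)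
    (f : (symRep p k p).IntertwiningMap σ) (x : Hom2 k p) : f x = 0 := by
  obtain ⟨q, rfl⟩ : ∃ q, p = q + 2 := ⟨p - 2, by have := (Fact.out : p.Prime).two_le; omega⟩
  -- In degree `p` Euler's identity gives `μ δ = p = 0`, so polarization takes values in the image
  -- of `κ`, a copy of `V_{p-1}`.
  obtain ⟨π, hπ⟩ := exists_comp_eq_of_injective (kappaI_injective (q + 2) k q)
    (deltaI (q + 2) k (q + 1)) fun x => by
      have : deltaL k (q + 1) x ∈ LinearMap.range (kappaL k q) := by
        rw [range_kappaL, LinearMap.mem_ker, muL_deltaL, CharP.cast_eq_zero, zero_smul]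
      exact this
  have hker : ∀ x, π x = 0 → ∃ l, frobI (q + 2) k l = x := fun x hx => by
    have h : deltaL k (q + 1) x = 0 := (hπ x).symm.trans (by rw [hx, map_zero])
    exact exists_frobI_eq (pderiv_one_eq_zero_of_deltaL h)
  have hsurj : Function.Surjective π := by
    refine LinearMap.range_eq_top.1 ((eq_bot_or_eq_top (p := q + 2) (by omega)
      (N := LinearMap.range π.toLinearMap) ?_).resolve_left fun h => ?_)
    · rintro g _ ⟨x, rfl⟩
      exact ⟨symRep (q + 2) k (q + 2) g x, π.isIntertwining _ _ g x⟩
    · have h2 : Function.Surjective (frobI (q + 2) k).toLinearMap := fun x =>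
        hker x (LinearMap.congr_fun (LinearMap.range_eq_bot.1 h) x)
      have := LinearMap.finrank_le_finrank_of_surjective h2
      rw [finrank_hom2, finrank_hom2] at this
      omega
  obtain ⟨f', hf'⟩ := exists_comp_eq hsurj f fun x hx => by
    obtain ⟨l, rfl⟩ := hker x hx
    exact hσ.apply_eq_zero (by omega) (f.comp (frobI (q + 2) k)) l
  rw [← hf']
  exact hσ.apply_eq_zero (by omega) f' _

/-- For `d = 0`, multiplication identifies the product with `V_2`. If `1 < d + 1 < p` the product
splits by Clebsch-Gordan, and if `d + 1 = p` it is an extension of `V_{p+1}` by `V_{p-1}`. -/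
theorem VFree.tprod_eq_zero {σ : Representation k (SL2 p) W} (hσ : VFree σ) {d : ℕ} (hd : d < p)
    (f : ((symRep p k d).tprod (symRep p k 1)).IntertwiningMap σ)
    (t : Hom2 k d ⊗[k] Hom2 k 1) : f t = 0 := by
  match d with
  | 0 =>
    have hinj : Function.Injective (muL k 0) := by
      refine (LinearMap.injective_iff_surjective_of_finrank_eq_finrank ?_).2 (muL_surjective 0)
      rw [Module.finrank_tensorProduct, finrank_hom2, finrank_hom2]
    obtain ⟨f', hf'⟩ := exists_comp_eq (π := muI p k 0) (muL_surjective 0) f fun x hx => by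
      rw [show x = 0 from hinj (hx.trans (map_zero _).symm), map_zero]
    rw [← hf']
    exact hσ.apply_eq_zero (Fact.out : p.Prime).one_lt f' _
  | e + 1 =>
    have h1 : ∀ x, f (kappaL k e x) = 0 := hσ.apply_eq_zero (by omega) (f.comp (kappaI p k e))
    obtain he | he : e + 2 < p ∨ e + 2 = p := by omega
    · have h2 : ∀ x, f (deltaL k (e + 1) x) = 0 :=
        hσ.apply_eq_zero he (f.comp (deltaI p k (e + 1)))
      have h3 := congrArg f (deltaL_muL_add_kappaL_lambdaL t)
      rw [map_add, h1, h2, zero_add, map_smul, eq_comm, smul_eq_zero] at h3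
      refine h3.resolve_left fun h => ?_
      exact absurd (Nat.le_of_dvd (by omega) ((CharP.cast_eq_zero_iff k p _).1 h)) (by omega)
    · obtain ⟨f', hf'⟩ := exists_comp_eq (π := muI p k (e + 1)) (muL_surjective _) f fun x hx => by
        obtain ⟨y, rfl⟩ : x ∈ LinearMap.range (kappaL k e) := by rw [range_kappaL]; exact hx
        exact h1 y
      rw [← hf']
      subst he
      exact hσ.symRep_self_eq_zero f' _

end Socle

/-! ### Functions on the group detect nonzero modules -/

section Functions

universe u v w

/-- The right regular representation on the functions on a group. -/
def regular (k : Type*) [Field k] (G : Type*) [Group G] : Representation k G (G → k) where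
  toFun g := LinearMap.funLeft k k (· * g)
  map_one' := by ext; simp [LinearMap.funLeft]
  map_mul' g h := by ext; simp [LinearMap.funLeft, mul_assoc]

@[simp]
theorem regular_apply {k : Type*} [Field k] {G : Type*} [Group G] (g : G) (f : G → k) (x : G) :
    regular k G g f x = f (x * g) := rfl

theorem regular_mul {k : Type*} [Field k] {G : Type*} [Group G] (g : G) (f f' : G → k) :
    regular k G g (f * f') = regular k G g f * regular k G g f' := rfl

/-- The orbit map of a vector, extended to functions. -/
def ofVector {k : Type*} [Field k] {G : Type*} [Group G] [Fintype G] {W : Type*} [AddCommGroup W]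
    [Module k W] (σ : Representation k G W) (w : W) : (regular k G).IntertwiningMap σ where
  toLinearMap := ∑ x, (LinearMap.proj x).smulRight (σ x⁻¹ w)
  isIntertwining' g := LinearMap.ext fun f => by
    simp only [LinearMap.comp_apply, LinearMap.sum_apply, LinearMap.smulRight_apply,
      LinearMap.proj_apply, regular_apply, map_sum, map_smul]
    refine Fintype.sum_equiv (Equiv.mulRight g) _ _ fun x => ?_
    rw [Equiv.coe_mulRight, ← Module.End.mul_apply, ← map_mul, mul_inv_rev, mul_inv_cancel_left]

theorem ofVector_single {k : Type*} [Field k] {G : Type*} [Group G] [Fintype G] [DecidableEq G]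
    {W : Type*} [AddCommGroup W] [Module k W] (σ : Representation k G W) (w : W) :
    ofVector σ w (Pi.single 1 1) = w := by
  change (∑ x, (LinearMap.proj x).smulRight (σ x⁻¹ w)) (Pi.single 1 1 : G → k) = w
  rw [LinearMap.sum_apply, Finset.sum_eq_single 1]
  · simp
  · intro x _ hx
    simp [hx]
  · simp

variable {p : ℕ} {k : Type u} [Field k] [CharP k p]

/-- The matrix coordinates, as functions on `SL₂(𝔽_p)`. -/
def matrixCoord (p : ℕ) (k : Type u) [Field k] [CharP k p] (r j : Fin 2) : SL2 p → k :=
  fun x => ZMod.castHom (dvd_refl p) k (x.1 r j)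

/-- A linear form, evaluated at a row of a matrix. -/
def rowI (p : ℕ) (k : Type u) [Field k] [CharP k p] (r : Fin 2) :
    (symRep p k 1).IntertwiningMap (regular k (SL2 p)) where
  toLinearMap := (LinearMap.toSpanSingleton k _ (matrixCoord p k r 0)).comp (linCoord k 0) +
    (LinearMap.toSpanSingleton k _ (matrixCoord p k r 1)).comp (linCoord k 1)
  isIntertwining' g := LinearMap.ext fun l => by
    rw [eq_linCoord l]
    simp only [LinearMap.comp_apply, map_add, map_smul, symRep_lin]
    congr 1
    all_goals
      congr 1
      funext x
      simp [matrixCoord, Matrix.mul_apply, Fin.sum_univ_two, mul_comm]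

theorem rowI_lin (r i : Fin 2) : rowI p k r (lin k i) = matrixCoord p k r i := by
  change linCoord k 0 (lin k i) • matrixCoord p k r 0 +
    linCoord k 1 (lin k i) • matrixCoord p k r 1 = _
  fin_cases i <;> simp

variable [Fact p.Prime]

theorem single_mem_adjoin (g : SL2 p) : (Pi.single g 1 : SL2 p → k) ∈
    Algebra.adjoin k (Set.range fun rj : Fin 2 × Fin 2 => matrixCoord p k rj.1 rj.2) := by
  -- By Fermat, each factor is the indicator that one matrix entry agrees with that of `g`.
  have h : (Pi.single g 1 : SL2 p → k) = ∏ rj : Fin 2 × Fin 2,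
      (1 - (matrixCoord p k rj.1 rj.2 -
        algebraMap k (SL2 p → k) (matrixCoord p k rj.1 rj.2 g)) ^ (p - 1)) := by
    have hp : p - 1 ≠ 0 := by have := (Fact.out : p.Prime).two_le; omega
    funext x
    rw [Finset.prod_apply]
    by_cases hx : x = g
    · subst hx
      simp [hp]
    · rw [Pi.single_eq_of_ne hx]
      obtain ⟨r, j, hrj⟩ : ∃ r j, x.1 r j ≠ g.1 r j := by
        by_contra! hcon
        exact hx (Subtype.ext (Matrix.ext hcon))
      refine (Finset.prod_eq_zero (Finset.mem_univ (r, j)) ?_).symm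
      have : matrixCoord p k r j x - matrixCoord p k r j g =
          ZMod.castHom (dvd_refl p) k (x.1 r j - g.1 r j) := by
        rw [map_sub]; rfl
      simp only [Pi.sub_apply, Pi.one_apply, Pi.pow_apply, Pi.algebraMap_apply,
        Algebra.algebraMap_self_apply, this]
      rw [← map_pow, ZMod.pow_card_sub_one_eq_one (sub_ne_zero.2 hrj), map_one, sub_self]
  rw [h]
  refine prod_mem fun rj _ => sub_mem (one_mem _) (pow_mem (sub_mem ?_ ?_) _)
  · exact Algebra.subset_adjoin ⟨rj, rfl⟩
  · exact Subalgebra.algebraMap_mem _ _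

theorem adjoin_matrixCoord_eq_top :
    Algebra.adjoin k (Set.range fun rj : Fin 2 × Fin 2 => matrixCoord p k rj.1 rj.2) = ⊤ := by
  rw [eq_top_iff]
  intro f _
  have : f = ∑ g, f g • (Pi.single g 1 : SL2 p → k) := by
    funext x
    simp [Finset.sum_apply, Pi.single_apply]
  rw [this]
  exact sum_mem fun g _ => Subalgebra.smul_mem _ (single_mem_adjoin g) _

/-- By adjunction, maps from `V_{d+1}` to `Hom(V_2, σ)` are maps from `V_{d+1} ⊗ V_2` to `σ`. -/
theorem VFree.linHom {W : Type*} [AddCommGroup W] [Module k W] {σ : Representation k (SL2 p) W}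
    (hσ : VFree σ) : VFree ((symRep p k 1).linHom σ) := by
  intro d hd f
  refine DFunLike.ext _ _ fun x => LinearMap.ext fun l => ?_
  let F : ((symRep p k d).tprod (symRep p k 1)).IntertwiningMap σ :=
    { toLinearMap := TensorProduct.lift f.toLinearMap
      isIntertwining' := fun g => TensorProduct.ext' fun x l => by
        have := LinearMap.congr_fun (f.isIntertwining _ _ g x) (symRep p k 1 g l)
        simp only [linHom_apply, LinearMap.comp_apply, inv_self_apply] at this
        simpa using this }
  exact hσ.tprod_eq_zero hd F (x ⊗ₜ l)

/-- Induction on the length of a monomial in the matrix entries, with `σ` varying: stripping off one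
entry replaces `σ` by `Hom(V_2, σ)`, which is again free of the `V_n`. -/
theorem VFree.apply_eq_zero_of_mem_closure {f : SL2 p → k} (hf : f ∈ Submonoid.closure
      (Set.range fun rj : Fin 2 × Fin 2 => matrixCoord p k rj.1 rj.2)) :
    ∀ {W : Type u} [AddCommGroup W] [Module k W] {σ : Representation k (SL2 p) W} (_ : VFree σ)
      (φ : (regular k (SL2 p)).IntertwiningMap σ), φ f = 0 := by
  induction hf using Submonoid.closure_induction_left with
  | one =>
    intro W _ _ σ hσ φ
    -- The constant functions form a copy of the trivial module `V_1`.
    let c : (symRep p k 0).IntertwiningMap (regular k (SL2 p)) :=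
      { toLinearMap := (LinearMap.toSpanSingleton k _ 1).comp
          (symRepZeroEquiv p k).toLinearEquiv.toLinearMap
        isIntertwining' := fun g => LinearMap.ext fun l => by
          funext x
          simp [symRep_zero_apply] }
    have hc : c ((symRepZeroEquiv p k).symm 1) = 1 := by
      change (symRepZeroEquiv p k) ((symRepZeroEquiv p k).symm 1) • (1 : SL2 p → k) = 1
      rw [Representation.Equiv.apply_symm_apply, one_smul]
    rw [← hc]
    exact hσ.apply_eq_zero (Fact.out : p.Prime).pos (φ.comp c) _
  | mul_left x hx f _ ih =>
    obtain ⟨⟨r, j⟩, rfl⟩ := hx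
    intro W _ _ σ hσ φ
    let ψ : (regular k (SL2 p)).IntertwiningMap ((symRep p k 1).linHom σ) :=
      { toLinearMap :=
          ((LinearMap.mul k (SL2 p → k)).compl₁₂ (rowI p k r).toLinearMap LinearMap.id).flip.compr₂
            φ.toLinearMap
        isIntertwining' := fun g => LinearMap.ext fun f => LinearMap.ext fun l => by
          change φ (rowI p k r l * regular k (SL2 p) g f) =
            σ g (φ (rowI p k r (symRep p k 1 g⁻¹ l) * f))
          rw [← φ.isIntertwining, regular_mul, ← (rowI p k r).isIntertwining, self_inv_apply] }
    have h := LinearMap.congr_fun (ih hσ.linHom ψ) (lin k j)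
    change φ (rowI p k r (lin k j) * f) = 0 at h
    rwa [rowI_lin] at h

/-- Any `w` is the image of the delta function at `1` under its orbit map. Monomials in the matrix
entries span all functions, and each is sent to zero. -/
theorem VFree.eq_zero {W : Type u} [AddCommGroup W] [Module k W] {σ : Representation k (SL2 p) W}
    (hσ : VFree σ) (w : W) : w = 0 := by
  classical
  rw [← ofVector_single σ w]
  have : (Pi.single 1 1 : SL2 p → k) ∈ Submodule.span k (Submonoid.closure
      (Set.range fun rj : Fin 2 × Fin 2 => matrixCoord p k rj.1 rj.2) : Set (SL2 p → k)) := by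
    rw [← Algebra.adjoin_eq_span, adjoin_matrixCoord_eq_top]
    trivial
  generalize (Pi.single 1 1 : SL2 p → k) = f at this ⊢
  induction this using Submodule.span_induction with
  | mem x hx => exact VFree.apply_eq_zero_of_mem_closure hx hσ _
  | zero => exact map_zero _
  | add x y _ _ hx hy => rw [map_add, hx, hy, add_zero]
  | smul c x _ hx => rw [map_smul, hx, smul_zero]

end Functions

/-! ### The Grothendieck ring modulo projectives -/

section Quotient

universe u v

theorem cls_eq_add_quotient {k : Type u} [Field k] {G : Type v} [Group G] {U W : FDRep k G}
    {f : U.rep.IntertwiningMap W.rep} (hf : Function.Injective f) :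
    ∃ Q : FDRep k G, cls W = cls U + cls Q ∧
      Module.finrank k U + Module.finrank k Q = Module.finrank k W := by
  let Q := FDRep.of (W.rep.quotient (LinearMap.range f.toLinearMap) (by
    rintro g _ ⟨x, rfl⟩
    exact ⟨U.rep g x, f.isIntertwining _ _ g x⟩))
  refine ⟨Q, cls_exact (V := Q) f ⟨Submodule.mkQ _, fun g => rfl⟩ hf (fun y => ?_)
    (Submodule.mkQ_surjective _), ?_⟩
  · exact Submodule.Quotient.mk_eq_zero _
  · have h1 := Submodule.finrank_quotient_add_finrank (LinearMap.range f.toLinearMap)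
    rw [LinearMap.finrank_range_of_inj hf] at h1
    rw [add_comm]
    exact h1

variable {p : ℕ} {k : Type u} [Field k] [CharP k p] [Fact p.Prime]

theorem injective_of_ne_zero {d : ℕ} (hd : d < p) {W : Type*} [AddCommGroup W] [Module k W]
    {σ : Representation k (SL2 p) W} {f : (symRep p k d).IntertwiningMap σ} (hf : f ≠ 0) :
    Function.Injective f := by
  refine LinearMap.ker_eq_bot.1 ((eq_bot_or_eq_top hd (N := LinearMap.ker f.toLinearMap)
    fun g v hv => ?_).resolve_right fun h => hf (IntertwiningMap.ext (LinearMap.ker_eq_top.1 h)))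
  have hv : f v = 0 := hv
  change f _ = 0
  rw [f.isIntertwining, hv, map_zero]

/-- A nonzero module receives a nonzero map from some simple `V_n` with `n ≤ p`, necessarily
injective; induction on dimension handles the quotient. -/
theorem cls_mem_closure (W : FDRep k (SL2 p)) :
    cls W ∈ AddSubgroup.closure {x | ∃ n ∈ Set.Icc 1 p, x = cls (VObj p k n)} := by
  induction hn : Module.finrank k W using Nat.strong_induction_on generalizing W with
  | _ n ih =>
  by_cases hW : VFree W.rep
  · have h0 : ∀ w : W, w = 0 := hW.eq_zero
    -- For the zero module, `0 → W → W → W → 0` is exact, whence `[W] = [W] + [W]`.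
    have := cls_exact (U := W) (W := W) (V := W) (IntertwiningMap.id _) (IntertwiningMap.id _)
      (fun _ _ h => h) (fun x => ⟨fun _ => ⟨x, rfl⟩, fun _ => h0 _⟩) (fun x => ⟨x, rfl⟩)
    rw [left_eq_add.1 this]
    exact zero_mem _
  · simp only [VFree, not_forall] at hW
    obtain ⟨d, hd, f, hf⟩ := hW
    obtain ⟨Q, hQ, hdim⟩ := cls_eq_add_quotient (U := VObj p k (d + 1)) (f := f)
      (injective_of_ne_zero hd hf)
    have hU : Module.finrank k (VObj p k (d + 1)) = d + 1 := finrank_hom2 d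
    rw [hQ]
    exact add_mem (AddSubgroup.subset_closure ⟨d + 1, ⟨by omega, by omega⟩, rfl⟩)
      (ih _ (by omega) Q rfl)

omit [CharP k p] in
theorem coset_eq_of_stableIso {M N : FDRep k (SL2 p)} (h : StableIso M.rep N.rep) :
    coset p k M = coset p k N :=
  Ideal.Quotient.eq.2 h.cls_sub_mem

theorem coset_V_p : coset p k (VObj p k p) = 0 := by
  refine Ideal.Quotient.eq_zero_iff_mem.2 (AddSubgroup.subset_closure ⟨VObj p k p, ?_, rfl⟩)
  obtain ⟨q, hq⟩ : ∃ q, p = q + 1 := ⟨p - 1, by have := (Fact.out : p.Prime).pos; omega⟩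
  have h := symRep_isProjective (p := p) (k := k)
  -- Stated for a variable `n` so that it can be replaced by a successor: the underlying space
  -- depends on `n - 1`.
  have key : ∀ n, n = p → 0 < n → IsProjective (symRep p k (n - 1)) → IsProjective (V p k n) := by
    intro n _ hn h
    obtain ⟨m, rfl⟩ : ∃ m, n = m + 1 := ⟨n - 1, by omega⟩
    exact h
  exact key p rfl (by omega) h

/-- The classes of `V_1, …, V_p` generate, and that of the projective `V_p` dies in the quotient. -/
theorem addMonoidHom_ext_of_coset {B : Type*} [AddCommGroup B]
    {φ ψ : (G0 k (SL2 p) ⧸ projIdeal k (SL2 p)) →+ B}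
    (h : ∀ i : Idx p, φ (coset p k (VObj p k i)) = ψ (coset p k (VObj p k i))) : φ = ψ := by
  let mk : G0 k (SL2 p) →+ G0 k (SL2 p) ⧸ projIdeal k (SL2 p) :=
    (Ideal.Quotient.mk (projIdeal k (SL2 p))).toAddMonoidHom
  have key : φ.comp mk = ψ.comp mk := G0.hom_ext fun W => by
    have : AddSubgroup.closure {x | ∃ n ∈ Set.Icc 1 p, x = cls (VObj p k n)} ≤
        (φ.comp mk).eqLocus (ψ.comp mk) := by
      rw [AddSubgroup.closure_le]
      rintro _ ⟨n, hn, rfl⟩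
      change φ (coset p k (VObj p k n)) = ψ (coset p k (VObj p k n))
      obtain hlt | rfl := hn.2.lt_or_eq
      · exact h ⟨n, hn.1, by omega⟩
      · rw [coset_V_p, map_zero, map_zero]
    exact this (cls_mem_closure W)
  refine AddMonoidHom.ext fun x => ?_
  obtain ⟨x, rfl⟩ := Ideal.Quotient.mk_surjective x
  exact DFunLike.congr_fun key x

omit [CharP k p] [Fact p.Prime] in
theorem coset_mul (M N : FDRep k (SL2 p)) : coset p k M * coset p k N = coset p k (tens M N) := by
  rw [coset, coset, ← map_mul, cls_mul_cls]
  rfl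

theorem coset_omega_mul (hp : 2 < p) {n : ℕ} (hn : n ∈ Set.Icc 1 (p - 1)) :
    coset p k (VObj p k (p - 1)) * coset p k (VObj p k n) = coset p k (VObj p k (p - n)) := by
  rw [coset_mul]
  exact coset_eq_of_stableIso (M := tens (VObj p k (p - 1)) (VObj p k n)) (N := VObj p k (p - n))
    (stableIso_V hp hn)

omit [Fact p.Prime] in
theorem coset_V_one : coset p k (VObj p k 1) = 1 :=
  congrArg (Ideal.Quotient.mk (projIdeal k (SL2 p)))
    (cls_equiv (V := VObj p k 1) (W := triv) (symRepZeroEquiv p k))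

theorem coset_omega_mul_self (hp : 2 < p) :
    coset p k (VObj p k (p - 1)) * coset p k (VObj p k (p - 1)) = 1 := by
  rw [coset_omega_mul hp ⟨by omega, le_rfl⟩, Nat.sub_sub_self (by omega), coset_V_one]

/-- The map is multiplication by the class of `V_{p-1}`, an involution because that class squares to
`1`. Equivariance is then commutativity of the ring. -/
theorem exists_unique_shift (hp : 2 < p) :
    ∃ ρ : (G0 k (SL2 p) ⧸ projIdeal k (SL2 p)) ≃+ (G0 k (SL2 p) ⧸ projIdeal k (SL2 p)),
      (∀ i : Idx p, ρ (coset p k (VObj p k i)) = coset p k (VObj p k (p - i))) ∧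
      (∀ ρ' : (G0 k (SL2 p) ⧸ projIdeal k (SL2 p)) ≃+ (G0 k (SL2 p) ⧸ projIdeal k (SL2 p)),
        (∀ i : Idx p, ρ' (coset p k (VObj p k i)) = coset p k (VObj p k (p - i))) → ρ' = ρ) ∧
      (∀ (a : G0 k (SL2 p)) (x : G0 k (SL2 p) ⧸ projIdeal k (SL2 p)), ρ (a • x) = a • ρ x) := by
  let ω := coset p k (VObj p k (p - 1))
  have hω : ω * ω = 1 := coset_omega_mul_self hp
  let ρ : (G0 k (SL2 p) ⧸ projIdeal k (SL2 p)) ≃+ (G0 k (SL2 p) ⧸ projIdeal k (SL2 p)) :=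
    { toFun := fun x => ω * x
      invFun := fun x => ω * x
      left_inv := fun x => by dsimp only; rw [← mul_assoc, hω, one_mul]
      right_inv := fun x => by dsimp only; rw [← mul_assoc, hω, one_mul]
      map_add' := mul_add ω }
  have hρ : ∀ i : Idx p, ρ (coset p k (VObj p k i)) = coset p k (VObj p k (p - i)) :=
    fun i => coset_omega_mul hp i.2
  refine ⟨ρ, hρ, fun ρ' hρ' => ?_, fun a x => mul_smul_comm a ω x⟩
  have := addMonoidHom_ext_of_coset (φ := ρ'.toAddMonoidHom) (ψ := ρ.toAddMonoidHom)
    fun i => (hρ' i).trans (hρ i).symm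
  exact AddEquiv.ext fun x => DFunLike.congr_fun this x

end Quotient

end SL2Rep

end

theorem proposition4p5 (p : ℕ) [Fact p.Prime] (hp : 2 < p)
    (k : Type*) [Field k] [IsAlgClosed k] [CharP k p] :
    -- `V_l` is a summand of `V_i ⊗ V_j` iff it is a summand of `V_{p-i} ⊗ V_{p-j}`
    (∀ i j l : SL2Rep.Idx p,
      SL2Rep.IsSummand (SL2Rep.V p k l) (SL2Rep.VV p k i j) ↔
        SL2Rep.IsSummand (SL2Rep.V p k l) (SL2Rep.VV p k (p - i) (p - j))) ∧
    -- `A⁽ⁿ⁾ = T A⁽ᵖ⁻ⁿ⁾ = A⁽ᵖ⁻ⁿ⁾ T`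
    (∀ n : SL2Rep.Idx p,
      SL2Rep.A p k n = SL2Rep.T p * SL2Rep.A p k (p - n) ∧
        SL2Rep.T p * SL2Rep.A p k (p - n) = SL2Rep.A p k (p - n) * SL2Rep.T p) ∧
    -- `T A T = A`
    (∀ n : SL2Rep.Idx p, SL2Rep.T p * SL2Rep.A p k n * SL2Rep.T p = SL2Rep.A p k n) ∧
    -- `i ↦ p - i` is a graph automorphism; the subgraphs induced on the even and on the odd
    -- vertices are isomorphic
    (∀ n : SL2Rep.Idx p,
      (∃ φ : (SL2Rep.graph p k n).Adj ≃r (SL2Rep.graph p k n).Adj,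
        ∀ i : SL2Rep.Idx p, (φ i : ℕ) = p - i) ∧
      Nonempty
        ((SL2Rep.inducedSubgraph (SL2Rep.graph p k n) {i | Even (i : ℕ)}).Adj ≃r
          (SL2Rep.inducedSubgraph (SL2Rep.graph p k n) {i | Odd (i : ℕ)}).Adj)) ∧
    -- the projective-free parts of `V_i ⊗ V_j` and `V_{p-i} ⊗ V_{p-j}` are isomorphic
    (∀ i j : SL2Rep.Idx p,
      SL2Rep.ProjectiveFreePartsIso (SL2Rep.VV p k i j) (SL2Rep.VV p k (p - i) (p - j))) ∧
    -- `[V_i ⊗ V_j] + 𝔭 = [V_{p-i} ⊗ V_{p-j}] + 𝔭`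
    (∀ i j : SL2Rep.Idx p,
      SL2Rep.coset p k (SL2Rep.tens (SL2Rep.VObj p k i) (SL2Rep.VObj p k j)) =
        SL2Rep.coset p k (SL2Rep.tens (SL2Rep.VObj p k (p - i)) (SL2Rep.VObj p k (p - j)))) ∧
    -- there is exactly one automorphism `ρ` of the group `G₀(kG)/𝔭` that maps `[V_i] + 𝔭` to
    -- `[V_{p-i}] + 𝔭` for all `i`, and it is `G₀(kG)`-equivariant
    (∃ ρ : (SL2Rep.G0 k (SL2Rep.SL2 p) ⧸ SL2Rep.projIdeal k (SL2Rep.SL2 p)) ≃+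
        (SL2Rep.G0 k (SL2Rep.SL2 p) ⧸ SL2Rep.projIdeal k (SL2Rep.SL2 p)),
      (∀ i : SL2Rep.Idx p, ρ (SL2Rep.coset p k (SL2Rep.VObj p k i)) =
        SL2Rep.coset p k (SL2Rep.VObj p k (p - i))) ∧
      (∀ ρ' : (SL2Rep.G0 k (SL2Rep.SL2 p) ⧸ SL2Rep.projIdeal k (SL2Rep.SL2 p)) ≃+
          (SL2Rep.G0 k (SL2Rep.SL2 p) ⧸ SL2Rep.projIdeal k (SL2Rep.SL2 p)),
        (∀ i : SL2Rep.Idx p, ρ' (SL2Rep.coset p k (SL2Rep.VObj p k i)) =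
          SL2Rep.coset p k (SL2Rep.VObj p k (p - i))) → ρ' = ρ) ∧
      (∀ (a : SL2Rep.G0 k (SL2Rep.SL2 p))
        (x : SL2Rep.G0 k (SL2Rep.SL2 p) ⧸ SL2Rep.projIdeal k (SL2Rep.SL2 p)),
        ρ (a • x) = a • ρ x)) := by
  exact ⟨fun i j l => SL2Rep.isSummand_VV_iff hp i.2 j.2 l.2,
    fun n => ⟨SL2Rep.T_mul_A hp n.2, SL2Rep.T_mul_A_comm hp _⟩,
    fun n => SL2Rep.T_mul_A_mul_T hp n,
    fun n => ⟨⟨SL2Rep.graphFlip k hp n, fun i => rfl⟩, SL2Rep.nonempty_inducedSubgraph_iso hp n⟩,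
    fun i j => (SL2Rep.stableIso_VV hp i.2 j.2).projectiveFreePartsIso,
    fun i j => SL2Rep.coset_eq_of_stableIso
      (M := SL2Rep.tens (SL2Rep.VObj p k i) (SL2Rep.VObj p k j))
      (N := SL2Rep.tens (SL2Rep.VObj p k (p - i)) (SL2Rep.VObj p k (p - j)))
      (SL2Rep.stableIso_VV hp i.2 j.2),
    SL2Rep.exists_unique_shift hp⟩
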